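/- Graphs are finite and undirected, and may have self-loops and multiple edges; a self-loop contributes $2$ to the degree of its vertex. For a graph $G$ and a positive integer $r$, let $G^{[r]}$ be the graph obtained from $G$ by replacing each edge with $r$ parallel edges. The Kirchhoff polynomial of a graph $H$ with edge set $E(H)$ is $\widetilde\Psi_H=\sum_T\prod_{e\in T}x_e\in\mathbb Z[x_e : e\in E(H)]$, where the sum runs over all spanning trees $T$ of $H$. If $v$ is a vertex of a $2k$-regular graph $H$ without self-loops, a transition $\tau$ at $v$ is a partition of the $2k$ edges at $v$ into $k$ pairs, and $H_\tau$ is the $2k$-regular graph obtained from $H$ by removing $v$ and its edges and adding, for each pair $\{vw,vw'\}$ of $\tau$, a new edge $ww'$ (a self-loop if $w=w'$). The Martin invariant $\mathsf M(H)\in\mathbb Q$ of a $2k$-regular graph $H$ with at least two vertices is given by the following rules: $\mathsf M(H)=0$ if $H$ has a self-loop; if $H$ has no self-loop, then $\mathsf M(H)=1/k!$ if $H$ has two vertices, $\mathsf M(H)=1$ if $H$ has three vertices, and otherwise $\mathsf M(H)=\sum_\tau \mathsf M(H_\tau)$, where $v$ is any vertex of $H$ and $\tau$ runs over all transitions at $v$.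 Let $G$ be a $2k$-regular graph with $n\ge 2$ vertices, and let $r$ be a positive integer. Then the rules give exactly one value $\mathsf M(G^{[r]})$, whichever vertices are chosen in the recursion. For every vertex $v$ of $G$ without self-loops, $$\mathsf M(G^{[r]})=\frac{(r!)^{k(n-2)}}{(kr)!}\;\Big[\prod_{e\in E(G\setminus v)}x_e^{\,r}\Big]\;\widetilde\Psi_{G\setminus v}^{\,kr},$$ where $[\,\cdot\,]$ denotes the coefficient of the given monomial. (If $G$ has no self-loops, then $G\setminus v$ has $k(n-2)$ edges.) In particular, if $n\ge 3$, then $\mathsf M(G^{[r]})$ is an integer that is divisible by $(r!)^{k(n-3)}$. -/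

import Mathlib

universe u w

open scoped Nat

/-- An undirected graph with vertex set `V` and edge set `E`; self-loops and parallel edges are
allowed. -/
structure Multigraph (V : Type u) (E : Type w) where
  /-- The unordered pair of end points of an edge; a self-loop at `v` has the ends `s(v, v)`. -/
  ends : E → Sym2 V

namespace Multigraph

variable {V : Type u} {E : Type w}

/-- The degree of a vertex: a self-loop contributes `2`. -/
noncomputable def degree (G : Multigraph V E) (v : V) : ℕ :=
  Nat.card {e : E // v ∈ G.ends e} + Nat.card {e : E // G.ends e = s(v, v)}

/-- Every vertex has degree `d`. -/
def IsRegular (G : Multigraph V E) (d : ℕ) : Prop :=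
  ∀ v, G.degree v = d

/-- There is no self-loop at `v`. -/
def NoLoopAt (G : Multigraph V E) (v : V) : Prop :=
  ∀ e, G.ends e ≠ s(v, v)

/-- The graph has no self-loop at all. -/
def Loopless (G : Multigraph V E) : Prop :=
  ∀ v, G.NoLoopAt v

/-- The graph `G \ v`: remove `v` and all edges at `v`. -/
def deleteVertex (G : Multigraph V E) (v : V) :
    Multigraph {x : V // x ≠ v} {e : E // v ∉ G.ends e} where
  ends e := (G.ends e.1).attachWith fun _ hx hxv => e.2 (hxv ▸ hx)

/-- The duplication `G^[r]`: replace every edge by `r` parallel edges. -/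
def duplicate (G : Multigraph V E) (r : ℕ) : Multigraph V (E × Fin r) where
  ends e := G.ends e.1

/-- The edges incident with `v`. -/
abbrev EdgesAt (G : Multigraph V E) (v : V) : Type w :=
  {e : E // v ∈ G.ends e}

/-- The other end of an edge at `v`. -/
noncomputable def neighbour (G : Multigraph V E) (v : V) (e : G.EdgesAt v) : V :=
  Sym2.Mem.other e.2

theorem neighbour_ne (G : Multigraph V E) {v : V} (hv : G.NoLoopAt v) (e : G.EdgesAt v) :
    G.neighbour v e ≠ v := by
  intro h
  apply hv e.1
  rw [← Sym2.other_spec e.2]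
  exact congrArg (fun x => s(v, x)) h

/-- A transition at a vertex `v` without self-loops: a partition of the set of edges at `v` into
pairs, that is, a set of unordered pairs of distinct edges at `v` such that every edge at `v`
belongs to exactly one of the pairs. -/
def Transition (G : Multigraph V E) (v : V) : Type w :=
  {P : Finset (Sym2 (G.EdgesAt v)) //
    (∀ p ∈ P, ¬ p.IsDiag) ∧ ∀ e : G.EdgesAt v, ∃! p, p ∈ P ∧ e ∈ p}

/-- The graph `G_τ`: remove `v` and its edges, and for every pair `{e, e'}` of the transition `τ`
add a new edge between the other ends of `e` and of `e'`. -/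
noncomputable def resolve (G : Multigraph V E) (v : V) (hv : G.NoLoopAt v) (τ : G.Transition v) :
    Multigraph {x : V // x ≠ v} ({e : E // v ∉ G.ends e} ⊕ {p // p ∈ τ.1}) where
  ends := Sum.elim (G.deleteVertex v).ends
    fun p => p.1.map fun e => ⟨G.neighbour v e, G.neighbour_ne hv e⟩

/-- `HasMartinInvariant k G q` says that `q` is a value for the Martin invariant of the
`2k`-regular graph `G` (with at least two vertices) that the defining rules produce, for some
choice of the vertex `v` in each application of the recursion:
a graph with a self-loop has the value `0`; a graph without self-loops has the value `1 / k!` if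
it has two vertices (a `2k`-fold edge), the value `1` if it has three vertices, and otherwise the
sum of the values of the graphs `G_τ` over all transitions `τ` at some vertex `v`. -/
inductive HasMartinInvariant (k : ℕ) :
    ∀ {V : Type u} {E : Type w}, Multigraph V E → ℚ → Prop
  | loop {V : Type u} {E : Type w} (G : Multigraph V E) (hn : 2 ≤ Nat.card V)
      (hG : ¬ G.Loopless) : HasMartinInvariant k G 0
  | two {V : Type u} {E : Type w} (G : Multigraph V E) (hn : Nat.card V = 2)
      (hG : G.Loopless) : HasMartinInvariant k G (1 / (k ! : ℚ))
  | three {V : Type u} {E : Type w} (G : Multigraph V E) (hn : Nat.card V = 3)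
      (hG : G.Loopless) : HasMartinInvariant k G 1
  | recursion {V : Type u} {E : Type w} (G : Multigraph V E) (hn : 4 ≤ Nat.card V)
      (hG : G.Loopless) (v : V) [Fintype (G.Transition v)] (m : G.Transition v → ℚ)
      (hm : ∀ τ, HasMartinInvariant k (G.resolve v (hG v) τ) (m τ)) :
      HasMartinInvariant k G (∑ τ, m τ)

/-- A spanning tree: a set of `n - 1` edges, where `n` is the number of vertices, that forms a
connected graph on all the vertices. -/
def IsSpanningTree (G : Multigraph V E) (T : Finset E) : Prop :=
  T.card + 1 = Nat.card V ∧ (SimpleGraph.fromEdgeSet (G.ends '' (T : Set E))).Connected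

open Classical in
/-- The Kirchhoff polynomial: the sum over all spanning trees `T` of the products of the variables
`x_e` with `e ∈ T`. -/
noncomputable def kirchhoff [Fintype E] (G : Multigraph V E) : MvPolynomial E ℤ :=
  ∑ T : Finset E with G.IsSpanningTree T, ∏ e ∈ T, MvPolynomial.X e

/-- The coefficient of `∏ x_e ^ r`, the product over all variables, in a polynomial. -/
noncomputable def diagonalCoeff [Finite E] (r : ℕ) (F : MvPolynomial E ℤ) : ℤ :=
  F.coeff (Finsupp.equivFunOnFinite.symm fun _ => r)

end Multigraph

/-! For a `2m`-regular graph `H` and a vertex `w`, let `c(H, w)` be the coefficient of the product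
of all variables in the `m`-th power of the Kirchhoff polynomial of `H \ w` (`treeCoeff`). The core
of the proof is that `c(H, w) / m!` obeys the rules of the Martin invariant. A loop forces the value
`0`; for two vertices `H \ w` is a single point, and for three it is an `m`-fold edge, whose
coefficient is `m!`.

For the recursion (`IsRegular.sum_treeCoeff_resolve`) the deleted vertex `w` stays fixed while
another vertex `v` is resolved. By the matrix-tree theorem the Kirchhoff polynomial is a Laplacian
minor. Eliminating the row of `v` by a Schur complement replaces the star of `v` by a mesh in which
the pair of edges `d, f` has weight `y_d * y_f`, up to powers of the sum `Y` of those `y_d` that do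
not lead to `w` (`topCoeff_star_mesh`). Regularity makes these powers cancel except for one factor
`Y` per edge between `v` and `w`. On the other side, each `G_τ` is the mesh restricted to the pairs
of `τ`. A product of pair weights `y_d * y_f` equals the product of all `y_d` exactly when the pairs
form a transition, so summing over `τ` amounts to substituting `y_d * y_f` for the variable of each
pair (`sum_coeff_pairing`). The two computations meet. Induction on the number of vertices then
gives existence and uniqueness of the value, and its independence of `w`.

Parallel edges enter the Laplacian only through the sum of their variables, and the squarefree part
of an `r`-th power of a sum of `r` variables carries the factor `r!`; this yields the formula for
`G^[r]`. Divisibility comes from the multinomial expansion of the power over spanning trees. -/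

/-! ### Cauchy–Binet for sums of rank one matrices -/

namespace Matrix

variable {R ι E : Type*} [CommRing R] [Fintype ι] [DecidableEq ι] [Fintype E]

/-- Expansion of the determinant of a weighted sum of the rank one matrices `b e i * b e j`. -/
theorem det_sum_mul_mul (b : E → ι → R) (x : E → R) :
    det (of fun i j => ∑ e, x e * (b e i * b e j)) =
      ∑ f : ι → E, (∏ i, x (f i)) * ((∏ i, b (f i) i) * det (of fun i j => b (f i) j)) := by
  have h : (of fun i j => ∑ e, x e * (b e i * b e j)) =
      fun i => ∑ e, (x e * b e i) • b e := by
    ext i j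
    simp [of_apply, Finset.sum_apply, mul_assoc]
  rw [h]
  have := (detRowAlternating (n := ι) (R := R)).toMultilinearMap.map_sum
    (fun i (e : E) => (x e * b e i) • b e)
  simp only [AlternatingMap.coe_multilinearMap] at this
  refine this.trans (Finset.sum_congr rfl fun f _ => ?_)
  have h2 := (detRowAlternating (n := ι) (R := R)).toMultilinearMap.map_smul_univ
    (fun i => x (f i) * b (f i) i) (fun i => b (f i))
  simp only [AlternatingMap.coe_multilinearMap] at h2
  refine h2.trans ?_
  rw [Finset.prod_mul_distrib, smul_eq_mul, mul_assoc]
  rfl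

/-- The maps with the image of the injective `f₀` are the `f₀ ∘ σ`. Permuting rows produces the sign
of `σ`, and the signed diagonal products add up to a second copy of the determinant. -/
theorem sum_prod_mul_det_of_image_eq [DecidableEq E] (b : E → ι → R) (x : E → R) (f₀ : ι → E)
    (hf₀ : Function.Injective f₀) :
    ∑ f : ι → E with Finset.univ.image f = Finset.univ.image f₀,
        (∏ i, x (f i)) * ((∏ i, b (f i) i) * det (of fun i j => b (f i) j)) =
      (∏ e ∈ Finset.univ.image f₀, x e) * det (of fun i j => b (f₀ i) j) ^ 2 := by
  have h1 : ∑ f : ι → E with Finset.univ.image f = Finset.univ.image f₀,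
        (∏ i, x (f i)) * ((∏ i, b (f i) i) * det (of fun i j => b (f i) j)) =
      ∑ σ : Equiv.Perm ι, (∏ i, x (f₀ (σ i))) *
        ((∏ i, b (f₀ (σ i)) i) * det (of fun i j => b (f₀ (σ i)) j)) := by
    symm
    refine Finset.sum_bij (fun σ _ => f₀ ∘ σ) ?_ ?_ ?_ ?_
    · intro σ _
      simp only [Finset.mem_filter, Finset.mem_univ, true_and]
      rw [← Finset.image_image, Finset.image_univ_equiv]
    · intro σ _ τ _ h
      ext i
      exact hf₀ (congrFun h i)
    · intro f hf
      simp only [Finset.mem_filter, Finset.mem_univ, true_and] at hf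
      have h : ∀ i, ∃ k, f₀ k = f i := by
        intro i
        have : f i ∈ Finset.univ.image f₀ := hf ▸ Finset.mem_image_of_mem _ (Finset.mem_univ i)
        simpa using this
      choose s hs using h
      have hsurj : Function.Surjective s := by
        intro k
        have : f₀ k ∈ Finset.univ.image f := hf ▸ Finset.mem_image_of_mem _ (Finset.mem_univ k)
        obtain ⟨i, -, hi⟩ := Finset.mem_image.1 this
        exact ⟨i, hf₀ (by rw [hs, hi])⟩
      refine ⟨Equiv.ofBijective s (Finite.surjective_iff_bijective.1 hsurj), Finset.mem_univ _, ?_⟩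
      ext i
      simpa using hs i
    · intro σ _
      rfl
  rw [h1]
  have h2 : ∀ σ : Equiv.Perm ι, (∏ i, x (f₀ (σ i))) = ∏ e ∈ Finset.univ.image f₀, x e := by
    intro σ
    rw [Finset.prod_image (fun i _ j _ h => hf₀ h), Equiv.prod_comp σ (fun i => x (f₀ i))]
  have h3 : ∀ σ : Equiv.Perm ι, det (of fun i j => b (f₀ (σ i)) j) =
      Equiv.Perm.sign σ * det (of fun i j => b (f₀ i) j) := by
    intro σ
    rw [← det_permute]
    rfl
  simp_rw [h2, h3]
  rw [← Finset.mul_sum, sq]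
  congr 1
  conv_rhs => arg 1; rw [det_apply']
  rw [Finset.sum_mul]
  refine Finset.sum_congr rfl fun σ _ => ?_
  simp only [of_apply]
  ring

end Matrix

/-! ### Incidence columns and the matrix-tree theorem -/

namespace Multigraph

variable {V : Type u} {E : Type w}

open Classical in
/-- The column of an oriented incidence matrix that belongs to an edge with given ends. -/
noncomputable def edgeCol (s : Sym2 V) (i : V) : ℤ :=
  (if i = s.out.1 then 1 else 0) - (if i = s.out.2 then 1 else 0)

/-- The Laplacian matrix of a single edge. -/
noncomputable def edgeLap (s : Sym2 V) (i j : V) : ℤ :=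
  edgeCol s i * edgeCol s j

open Classical in
-- The orientation chosen by `Quot.out` is irrelevant: reversing it changes the sign of both
-- factors.
theorem edgeLap_mk (a b i j : V) :
    edgeLap s(a, b) i j = ((if i = a then 1 else 0) - (if i = b then 1 else 0)) *
      ((if j = a then 1 else 0) - (if j = b then 1 else 0)) := by
  have h : s(Quot.out s(a, b) |>.1, Quot.out s(a, b) |>.2) = s(a, b) := Quot.out_eq _
  unfold edgeLap edgeCol
  rcases Sym2.eq_iff.1 h with ⟨h1, h2⟩ | ⟨h1, h2⟩
  · rw [h1, h2]
  · rw [h1, h2]; ring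

theorem edgeLap_map {V' : Type*} {θ : V → V'} (hθ : Function.Injective θ) (s : Sym2 V) (i j : V) :
    edgeLap (s.map θ) (θ i) (θ j) = edgeLap s i j := by
  induction s with
  | _ a b =>
    classical
    have h : ∀ x y : V, (if θ x = θ y then (1 : ℤ) else 0) = if x = y then 1 else 0 :=
      fun x y => if_congr hθ.eq_iff rfl rfl
    rw [Sym2.map_mk, edgeLap_mk, edgeLap_mk, h, h, h, h]

theorem edgeLap_diag (a i j : V) : edgeLap s(a, a) i j = 0 := by
  simp [edgeLap_mk]

theorem edgeLap_eq_zero_of_notMem {s : Sym2 V} {i : V} (h : i ∉ s) (j : V) :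
    edgeLap s i j = 0 := by
  induction s with
  | _ a b =>
    simp only [Sym2.mem_iff, not_or] at h
    simp [edgeLap_mk, h.1, h.2]

theorem edgeLap_comm (s : Sym2 V) (i j : V) : edgeLap s i j = edgeLap s j i :=
  mul_comm _ _

theorem sum_edgeCol_mul {R ι : Type*} [CommRing R] [Fintype ι] {j : ι → V}
    (hj : Function.Injective j) {a : V} (hja : Set.range j = {a}ᶜ) (s : Sym2 V) (Y : V → R)
    (hY : Y a = 0) :
    ∑ i, ((edgeCol s (j i) : ℤ) : R) * Y (j i) = Y s.out.1 - Y s.out.2 := by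
  classical
  have key : ∀ c : V, ∑ i, (if j i = c then (1 : R) else 0) * Y (j i) = Y c := by
    intro c
    by_cases hc : c = a
    · subst hc
      rw [hY]
      refine Finset.sum_eq_zero fun i _ => ?_
      have : j i ≠ c := by
        have : j i ∈ ({c} : Set V)ᶜ := hja ▸ Set.mem_range_self i
        simpa using this
      simp [this]
    · have : c ∈ Set.range j := by rw [hja]; simpa using hc
      obtain ⟨i, rfl⟩ := this
      simp [hj.eq_iff]
  simp only [edgeCol, Int.cast_sub, Int.cast_ite, Int.cast_one, Int.cast_zero, sub_mul,
    Finset.sum_sub_distrib, key]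

section MatrixTree

variable {R ι : Type*} [CommRing R] [Fintype ι] [DecidableEq ι] {j : ι → V} {a : V}

/-- The indicator function of a component that avoids the grounded vertex `a` is a nonzero kernel
vector. -/
theorem det_edgeCol_eq_zero (hj : Function.Injective j) (hja : Set.range j = {a}ᶜ)
    (G : Multigraph V E) (f : ι → E)
    (h : ¬ (SimpleGraph.fromEdgeSet (G.ends '' Set.range f)).Connected) :
    (Matrix.of fun i i' => edgeCol (G.ends (f i)) (j i')).det = 0 := by
  classical
  set S := SimpleGraph.fromEdgeSet (G.ends '' Set.range f) with hS
  have hc : ∃ c, ¬ S.Reachable a c := by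
    by_contra! hc
    have : Nonempty V := ⟨a⟩
    exact h ⟨fun x y => (hc x).symm.trans (hc y)⟩
  obtain ⟨c, hc⟩ := hc
  let Y : V → ℤ := fun y => if S.Reachable y c then 1 else 0
  have hYa : Y a = 0 := by simp [Y, hc]
  refine Matrix.exists_mulVec_eq_zero_iff.1 ⟨fun i => Y (j i), ?_, ?_⟩
  · intro h0
    have hca : c ≠ a := by rintro rfl; exact hc (SimpleGraph.Reachable.refl _)
    have : c ∈ Set.range j := by rw [hja]; simpa using hca
    obtain ⟨i, rfl⟩ := this
    have := congrFun h0 i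
    simp [Y] at this
  · ext i
    have := sum_edgeCol_mul hj hja (G.ends (f i)) Y hYa
    simp only [Int.cast_id] at this
    simp only [Matrix.mulVec, dotProduct, Matrix.of_apply, Pi.zero_apply]
    rw [this]
    set s := G.ends (f i)
    have hs : s(s.out.1, s.out.2) = s := Quot.out_eq _
    by_cases hd : s.out.1 = s.out.2
    · rw [hd, sub_self]
    · have hadj : S.Adj s.out.1 s.out.2 := by
        rw [hS, SimpleGraph.fromEdgeSet_adj]
        exact ⟨⟨f i, ⟨i, rfl⟩, hs.symm⟩, hd⟩
      have : S.Reachable s.out.1 c ↔ S.Reachable s.out.2 c :=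
        ⟨fun h => hadj.symm.reachable.trans h, fun h => hadj.reachable.trans h⟩
      simp [Y, this]

/-- A kernel vector, extended by `0` to `a`, is constant along edges and hence zero by
connectedness. The argument works over every field, so the integer determinant is nonzero modulo
every prime. -/
theorem det_edgeCol_ne_zero (hj : Function.Injective j) (hja : Set.range j = {a}ᶜ)
    (G : Multigraph V E) (f : ι → E)
    (h : (SimpleGraph.fromEdgeSet (G.ends '' Set.range f)).Connected) (F : Type*) [Field F] :
    (((Matrix.of fun i i' => edgeCol (G.ends (f i)) (j i')).det : ℤ) : F) ≠ 0 := by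
  classical
  set S := SimpleGraph.fromEdgeSet (G.ends '' Set.range f) with hS
  intro h0
  rw [show (((Matrix.of fun i i' => edgeCol (G.ends (f i)) (j i')).det : ℤ) : F) =
    (Int.castRingHom F) (Matrix.det _) from rfl, RingHom.map_det] at h0
  obtain ⟨y, hy0, hy⟩ := Matrix.exists_mulVec_eq_zero_iff.2 h0
  let Y : V → F := fun x => if hx : ∃ i, j i = x then y hx.choose else 0
  have hYj : ∀ i, Y (j i) = y i := by
    intro i
    have hx : ∃ i', j i' = j i := ⟨i, rfl⟩
    simp only [Y, hx, dif_pos]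
    rw [hj hx.choose_spec]
  have hYa : Y a = 0 := by
    have : ¬ ∃ i, j i = a := by
      rintro ⟨i, hi⟩
      have : j i ∈ ({a} : Set V)ᶜ := hja ▸ Set.mem_range_self i
      exact this hi
    simp [Y, this]
  have hstep : ∀ x z, S.Adj x z → Y x = Y z := by
    intro x z hxz
    rw [hS, SimpleGraph.fromEdgeSet_adj] at hxz
    obtain ⟨⟨_, ⟨i, rfl⟩, hi⟩, -⟩ := hxz
    have h1 := sum_edgeCol_mul hj hja (G.ends (f i)) Y hYa
    have h2 := congrFun hy i
    simp only [Matrix.mulVec, dotProduct, RingHom.mapMatrix_apply, Matrix.map_apply,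
      Matrix.of_apply, Pi.zero_apply, eq_intCast] at h2
    simp only [hYj] at h1
    rw [h1, sub_eq_zero] at h2
    have hs : s((G.ends (f i)).out.1, (G.ends (f i)).out.2) = s(x, z) :=
      (Quot.out_eq _).trans hi
    rcases Sym2.eq_iff.1 hs with ⟨h3, h4⟩ | ⟨h3, h4⟩
    · rwa [h3, h4] at h2
    · rw [h3, h4] at h2; exact h2.symm
  apply hy0
  ext i
  have : S.Reachable (j i) a := h.preconnected _ _
  obtain ⟨p⟩ := this
  have hp : ∀ {x z : V} (p : S.Walk x z), Y x = Y z := by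
    intro x z p
    induction p with
    | nil => rfl
    | cons hadj _ ih => rw [hstep _ _ hadj, ih]
  rw [← hYj, hp p, hYa]
  rfl

theorem det_edgeCol_sq (hj : Function.Injective j) (hja : Set.range j = {a}ᶜ)
    (G : Multigraph V E) (f : ι → E)
    (h : (SimpleGraph.fromEdgeSet (G.ends '' Set.range f)).Connected) :
    (Matrix.of fun i i' => edgeCol (G.ends (f i)) (j i')).det ^ 2 = 1 := by
  set d := (Matrix.of fun i i' => edgeCol (G.ends (f i)) (j i')).det with hd
  have h1 : d.natAbs = 1 := by
    -- A prime factor of the determinant would make it vanish over `ZMod p`; this replaces an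
    -- induction for total unimodularity.
    rw [Nat.eq_one_iff_not_exists_prime_dvd]
    intro p hp hpd
    have : Fact p.Prime := ⟨hp⟩
    apply det_edgeCol_ne_zero hj hja G f h (ZMod p)
    rw [← hd, ZMod.intCast_zmod_eq_zero_iff_dvd]
    exact Int.natCast_dvd.2 hpd
  rw [← Int.natAbs_sq, h1]
  rfl

/-- The matrix-tree theorem. -/
theorem aeval_kirchhoff [Algebra ℤ R] [Fintype E] (hj : Function.Injective j) (hja : Set.range j = {a}ᶜ)
    (G : Multigraph V E) (x : E → R) :
    MvPolynomial.aeval x G.kirchhoff =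
      (Matrix.of fun i i' => ∑ e, x e * ((edgeLap (G.ends e) (j i) (j i') : ℤ) : R)).det := by
  classical
  have hcard : Nat.card V = Fintype.card ι + 1 := by
    let e : Option ι → V := fun o => o.elim a j
    have he : Function.Bijective e := by
      have hne : ∀ i, j i ≠ a := fun i hi => by
        have : j i ∈ ({a} : Set V)ᶜ := hja ▸ Set.mem_range_self i
        exact this hi
      constructor
      · rintro (_ | i) (_ | i') h
        · rfl
        · exact absurd h.symm (hne i')
        · exact absurd h (hne i)
        · exact congrArg _ (hj h)
      · intro x
        by_cases hx : x = a
        · exact ⟨none, hx.symm⟩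
        · have : x ∈ Set.range j := by rw [hja]; simpa using hx
          obtain ⟨i, rfl⟩ := this
          exact ⟨some i, rfl⟩
    rw [← Nat.card_congr (Equiv.ofBijective e he), Nat.card_eq_fintype_card, Fintype.card_option]
  have hL : (Matrix.of fun i i' => ∑ e, x e * ((edgeLap (G.ends e) (j i) (j i') : ℤ) : R)) =
      Matrix.of fun i i' => ∑ e, x e * (((edgeCol (G.ends e) (j i) : ℤ) : R) *
        ((edgeCol (G.ends e) (j i') : ℤ) : R)) := by
    ext i i'
    simp [edgeLap]
  rw [hL, Matrix.det_sum_mul_mul (fun e i => ((edgeCol (G.ends e) (j i) : ℤ) : R)) x]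
  -- The maps `f` are grouped by their image `T`. If `T` has the size of a tree, the fibre gives a
  -- squared determinant; otherwise no `f` in the fibre is injective and two rows coincide.
  rw [← Finset.sum_fiberwise (s := Finset.univ) (g := fun f : ι → E => Finset.univ.image f)]
  rw [kirchhoff, map_sum, Finset.sum_filter]
  refine Finset.sum_congr rfl fun T _ => ?_
  simp only [map_prod, MvPolynomial.aeval_X]
  by_cases hT : T.card = Fintype.card ι
  · obtain ⟨e⟩ : Nonempty (ι ≃ T) := ⟨Fintype.equivOfCardEq (by simp [hT])⟩
    let f₀ : ι → E := fun i => e i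
    have hf₀ : Function.Injective f₀ := fun i i' h => e.injective (Subtype.ext h)
    have himg : Finset.univ.image f₀ = T := by
      ext t
      simp only [Finset.mem_image, Finset.mem_univ, true_and]
      constructor
      · rintro ⟨i, rfl⟩; exact (e i).2
      · intro ht; exact ⟨e.symm ⟨t, ht⟩, by simp [f₀]⟩
    have hrange : Set.range f₀ = (T : Set E) := by rw [← himg]; simp
    have h2 := Matrix.sum_prod_mul_det_of_image_eq
      (fun e i => ((edgeCol (G.ends e) (j i) : ℤ) : R)) x f₀ hf₀
    rw [himg] at h2
    rw [h2]
    have hdet : (Matrix.of fun i i' => ((edgeCol (G.ends (f₀ i)) (j i') : ℤ) : R)).det =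
        (((Matrix.of fun i i' => edgeCol (G.ends (f₀ i)) (j i')).det : ℤ) : R) := by
      rw [show (((Matrix.of fun i i' => edgeCol (G.ends (f₀ i)) (j i')).det : ℤ) : R) =
        (Int.castRingHom R) (Matrix.det _) from rfl, RingHom.map_det]
      rfl
    rw [hdet]
    by_cases hc : (SimpleGraph.fromEdgeSet (G.ends '' (T : Set E))).Connected
    · rw [if_pos ⟨by rw [hT, hcard], hc⟩, ← Int.cast_pow,
        det_edgeCol_sq hj hja G f₀ (by rwa [hrange])]
      simp
    · rw [if_neg (fun h => hc h.2), det_edgeCol_eq_zero hj hja G f₀ (by rwa [hrange])]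
      simp
  · rw [if_neg (fun h => hT (by have := h.1; omega))]
    symm
    refine Finset.sum_eq_zero fun f hf => ?_
    simp only [Finset.mem_filter, Finset.mem_univ, true_and] at hf
    have hni : ¬ Function.Injective f := by
      intro hinj
      apply hT
      rw [← hf, Finset.card_image_of_injective _ hinj, Finset.card_univ]
    simp only [Function.Injective, not_forall] at hni
    obtain ⟨i, i', h1, h2⟩ := hni
    rw [Matrix.det_zero_of_row_eq h2 (by ext k; simp [h1])]
    simp

end MatrixTree

end Multigraph

/-! ### The coefficient of the product of all variables -/

namespace MvPolynomial

variable {R S σ ρ E : Type*} [CommRing R] [CommRing S]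

/-- The coefficient of the product of all variables. -/
noncomputable def topCoeff [Finite σ] (F : MvPolynomial σ R) : R :=
  F.coeff (Finsupp.equivFunOnFinite.symm fun _ => 1)

theorem topCoeff_add [Finite σ] (F G : MvPolynomial σ R) :
    topCoeff (F + G) = topCoeff F + topCoeff G :=
  coeff_add _ _ _

theorem topCoeff_sum [Finite σ] {ι : Type*} (s : Finset ι) (F : ι → MvPolynomial σ R) :
    topCoeff (∑ i ∈ s, F i) = ∑ i ∈ s, topCoeff (F i) :=
  coeff_sum _ _ _

theorem topCoeff_C_mul [Finite σ] (c : R) (F : MvPolynomial σ R) :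
    topCoeff (C c * F) = c * topCoeff F :=
  coeff_C_mul _ _ _

theorem topCoeff_map [Finite σ] (f : R →+* S) (F : MvPolynomial σ R) :
    topCoeff (map f F) = f (topCoeff F) :=
  coeff_map _ _ _

theorem univ_prod_X_pow [Fintype σ] (a : σ → ℕ) :
    (∏ i, (X i : MvPolynomial σ R) ^ a i) = monomial (Finsupp.equivFunOnFinite.symm a) 1 := by
  rw [monomial_eq, C_1, one_mul, Finsupp.prod_fintype _ _ (fun _ => pow_zero _)]
  rfl

theorem coeff_univ_prod_X_pow [Fintype σ] (a b : σ → ℕ) [Decidable (a = b)] :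
    (∏ i, (X i : MvPolynomial σ R) ^ a i).coeff (Finsupp.equivFunOnFinite.symm b) =
      if a = b then 1 else 0 := by
  classical
  rw [univ_prod_X_pow, coeff_monomial]
  exact if_congr (Finsupp.equivFunOnFinite.symm.injective.eq_iff) rfl rfl

theorem coeff_univ_prod_X_pow' [Fintype σ] (a : σ → ℕ) (s : σ →₀ ℕ) [Decidable (a = ⇑s)] :
    (∏ i, (X i : MvPolynomial σ R) ^ a i).coeff s = if a = ⇑s then 1 else 0 := by
  conv_lhs => rw [← Finsupp.equivFunOnFinite_symm_coe s]
  rw [coeff_univ_prod_X_pow]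

theorem topCoeff_prod_X [Fintype σ] : topCoeff (∏ i, (X i : MvPolynomial σ R)) = 1 := by
  classical
  have := coeff_univ_prod_X_pow (R := R) (fun _ : σ => 1) (fun _ => 1)
  simpa [topCoeff] using this

/-- Two additive functions on polynomials agree if they agree on all `c * ∏ X i ^ a i`. -/
theorem eq_of_forall_prod_X_pow [Fintype σ] {A : Type*} [AddCommMonoid A]
    (f g : MvPolynomial σ R → A) (hf : ∀ p q, f (p + q) = f p + f q)
    (hg : ∀ p q, g (p + q) = g p + g q)
    (h : ∀ (c : R) (a : σ → ℕ), f (C c * ∏ i, X i ^ a i) = g (C c * ∏ i, X i ^ a i))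
    (F : MvPolynomial σ R) : f F = g F := by
  induction F using MvPolynomial.induction_on' with
  | monomial s c =>
    have : monomial s c = C c * ∏ i, X i ^ s i := by
      rw [univ_prod_X_pow, C_mul_monomial, mul_one, Finsupp.equivFunOnFinite_symm_coe]
    rw [this, h]
  | add p q hp hq => rw [hf, hg, hp, hq]

/-- Iterated coefficient extraction. -/
theorem topCoeff_eq_topCoeff_topCoeff [Fintype E] [Fintype σ] [Fintype ρ] (ε : E ≃ σ ⊕ ρ)
    (F : MvPolynomial E R) :
    topCoeff F = topCoeff (topCoeff (aeval (fun e => Sum.elim X (fun r => C (X r)) (ε e)) F :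
      MvPolynomial σ (MvPolynomial ρ R))) := by
  classical
  refine eq_of_forall_prod_X_pow topCoeff (fun F => topCoeff (topCoeff (aeval (fun e =>
    Sum.elim X (fun r => C (X r)) (ε e)) F : MvPolynomial σ (MvPolynomial ρ R))))
    topCoeff_add ?_ ?_ F
  · intro p q
    simp only [map_add, topCoeff_add]
  · intro c a
    have h1 : (aeval (fun e => Sum.elim X (fun r => C (X r)) (ε e)) (C c * ∏ i, X i ^ a i) :
        MvPolynomial σ (MvPolynomial ρ R)) =
        C (C c * ∏ r, X r ^ a (ε.symm (Sum.inr r))) * ∏ s, X s ^ a (ε.symm (Sum.inl s)) := by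
      rw [map_mul, map_prod]
      simp only [map_pow, aeval_X, aeval_C]
      rw [← ε.symm.prod_comp]
      simp only [Equiv.apply_symm_apply, Fintype.prod_sum_type, Sum.elim_inl, Sum.elim_inr]
      rw [C_mul, map_prod]
      simp only [map_pow]
      rw [mul_assoc, mul_comm (∏ s, _ : MvPolynomial σ (MvPolynomial ρ R)), IsScalarTower.algebraMap_apply R (MvPolynomial ρ R)
        (MvPolynomial σ (MvPolynomial ρ R))]
      rfl
    simp only [h1, topCoeff_C_mul]
    simp only [topCoeff, coeff_univ_prod_X_pow]
    have h2 : a = (fun _ => 1) ↔ ((fun s => a (ε.symm (Sum.inl s))) = fun _ => 1) ∧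
        ((fun r => a (ε.symm (Sum.inr r))) = fun _ => 1) := by
      constructor
      · rintro rfl; exact ⟨rfl, rfl⟩
      · rintro ⟨h3, h4⟩
        ext e
        obtain ⟨x, rfl⟩ := ε.symm.surjective e
        cases x with
        | inl s => exact congrFun h3 s
        | inr r => exact congrFun h4 r
    by_cases h3 : (fun s => a (ε.symm (Sum.inl s))) = fun _ => 1
    · by_cases h4 : (fun r => a (ε.symm (Sum.inr r))) = fun _ => 1
      · rw [if_pos (h2.2 ⟨h3, h4⟩), if_pos h3, mul_one, mul_one, coeff_C_mul,
          coeff_univ_prod_X_pow, if_pos h4, mul_one]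
      · rw [if_neg (fun h => h4 (h2.1 h).2), if_pos h3, mul_one, coeff_C_mul, coeff_univ_prod_X_pow,
          if_neg h4]
    · rw [if_neg (fun h => h3 (h2.1 h).1), if_neg h3, mul_zero, mul_zero, coeff_zero]

theorem topCoeff_rename_equiv [Finite E] [Finite σ] (ε : E ≃ σ) (F : MvPolynomial E R) :
    topCoeff (rename ε F) = topCoeff F := by
  have := coeff_rename_mapDomain ε ε.injective F (Finsupp.equivFunOnFinite.symm fun _ => 1)
  rw [topCoeff, topCoeff, ← this]
  congr 1
  ext s
  obtain ⟨e, rfl⟩ := ε.surjective s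
  rw [Finsupp.mapDomain_apply ε.injective]
  rfl

theorem topCoeff_aeval_C_mul_X [Fintype σ] (Y : R) (F : MvPolynomial σ R) :
    topCoeff (aeval (fun i => C Y * X i) F : MvPolynomial σ R) =
      Y ^ Fintype.card σ * topCoeff F := by
  classical
  refine eq_of_forall_prod_X_pow (fun F => topCoeff (aeval (fun i => C Y * X i) F :
    MvPolynomial σ R)) (fun F => Y ^ Fintype.card σ * topCoeff F) ?_ ?_ ?_ F
  · intro p q
    simp only [map_add, topCoeff_add]
  · intro p q
    simp only [topCoeff_add, mul_add]
  · intro c a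
    simp only [map_mul, map_prod, map_pow, aeval_X, aeval_C, mul_pow, Finset.prod_mul_distrib]
    simp only [← C_pow, ← map_prod, algebraMap_eq, topCoeff_C_mul]
    rw [topCoeff, coeff_univ_prod_X_pow]
    split_ifs with h
    · subst h
      simp
      ring
    · simp

/-- Supplying the missing variables as factors allows coefficients for `G \ v` to be read off in the
variables of all edges of `G`. -/
theorem topCoeff_rename_mul_prod_X [Fintype E] {P : E → Prop} [DecidablePred P]
    (F : MvPolynomial {e // P e} R) :
    topCoeff (rename Subtype.val F * ∏ e : {e // ¬ P e}, X e.1) = topCoeff F := by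
  rw [topCoeff_eq_topCoeff_topCoeff (Equiv.sumCompl P).symm]
  have h1 : ∀ e : {e // P e}, (Equiv.sumCompl P).symm e.1 = Sum.inl e := fun e => by simp
  have h2 : ∀ e : {e // ¬ P e}, (Equiv.sumCompl P).symm e.1 = Sum.inr e := fun e => by simp
  rw [map_mul, aeval_rename, map_prod]
  simp only [aeval_X, h2, Sum.elim_inr, Function.comp_def, h1, Sum.elim_inl]
  have h3 : (aeval (fun e : {e // P e} => (X e : MvPolynomial {e // P e}
      (MvPolynomial {e // ¬ P e} R))) F) = map C F := by
    rw [aeval_def, eval₂_eq']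
    conv_rhs => rw [← F.support_sum_monomial_coeff]
    rw [map_sum]
    refine Finset.sum_congr rfl fun d _ => ?_
    rw [map_monomial, univ_prod_X_pow]
    have : algebraMap R (MvPolynomial {e // P e} (MvPolynomial {e // ¬ P e} R)) (coeff d F) =
      C (C (coeff d F)) := rfl
    rw [this, C_mul_monomial, mul_one, Finsupp.equivFunOnFinite_symm_coe]
  rw [h3, ← map_prod, mul_comm, topCoeff_C_mul, topCoeff_map, mul_comm, topCoeff_C_mul,
    topCoeff_prod_X, mul_one]

end MvPolynomial

/-! ### Vertex deletion as a minor of the Laplacian -/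

namespace Multigraph

open MvPolynomial

variable {V : Type u} {E : Type w}

section

variable {R ι : Type*} [CommRing R] [Fintype ι] [DecidableEq ι] {j : ι → V} {v a : V}

theorem aeval_kirchhoff_deleteVertex [Algebra ℤ R] (G : Multigraph V E) [Fintype {e : E // v ∉ G.ends e}]
    (hj : Function.Injective j) (hva : v ≠ a)
    (hja : Set.range j = {v, a}ᶜ) (x : {e : E // v ∉ G.ends e} → R) :
    aeval x (G.deleteVertex v).kirchhoff = (Matrix.of fun i i' =>
      ∑ e, x e * ((edgeLap (G.ends e.1) (j i) (j i') : ℤ) : R)).det := by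
  have hjv : ∀ i, j i ≠ v := fun i h => by
    have : j i ∈ ({v, a} : Set V)ᶜ := hja ▸ Set.mem_range_self i
    exact this (Or.inl h)
  have hja' : ∀ i, j i ≠ a := fun i h => by
    have : j i ∈ ({v, a} : Set V)ᶜ := hja ▸ Set.mem_range_self i
    exact this (Or.inr h)
  let j' : ι → {x : V // x ≠ v} := fun i => ⟨j i, hjv i⟩
  have hj' : Function.Injective j' := fun i i' h => hj (congrArg Subtype.val h)
  have hr : Set.range j' = {⟨a, hva.symm⟩}ᶜ := by
    ext ⟨x, hx⟩
    simp only [Set.mem_range, Set.mem_compl_iff, Set.mem_singleton_iff, Subtype.mk.injEq]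
    constructor
    · rintro ⟨i, hi⟩ rfl
      exact hja' i (congrArg Subtype.val hi)
    · intro hxa
      have : x ∈ Set.range j := by
        rw [hja]
        rintro (h | h)
        · exact hx h
        · exact hxa h
      obtain ⟨i, hi⟩ := this
      exact ⟨i, Subtype.ext hi⟩
  rw [aeval_kirchhoff hj' hr]
  congr 1
  ext i i'
  simp only [Matrix.of_apply]
  refine Finset.sum_congr rfl fun e _ => ?_
  congr 2
  have := edgeLap_map Subtype.val_injective ((G.deleteVertex v).ends e) (j' i) (j' i')
  rw [← this]
  congr 1
  simp [deleteVertex, Sym2.attachWith_map_subtypeVal]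

open Classical in
/-- The Kirchhoff polynomial of `G \ v`, evaluated at weights for all edges of `G`, as a minor of
a Laplacian matrix. -/
theorem aeval_kirchhoff_deleteVertex' [Algebra ℤ R] [Fintype E] (G : Multigraph V E)
    [Fintype {e : E // v ∉ G.ends e}]
    (hj : Function.Injective j) (hva : v ≠ a)
    (hja : Set.range j = {v, a}ᶜ) (x : E → R) :
    aeval (fun e => x e.1) (G.deleteVertex v).kirchhoff = (Matrix.of fun i i' =>
      ∑ e, (if v ∈ G.ends e then 0 else x e) *
        ((edgeLap (G.ends e) (j i) (j i') : ℤ) : R)).det := by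
  rw [aeval_kirchhoff_deleteVertex G hj hva hja]
  congr 1
  ext i i'
  simp only [Matrix.of_apply, ite_mul, zero_mul]
  rw [Finset.sum_ite]
  simp only [Finset.sum_const_zero, zero_add]
  rw [Finset.sum_subtype (p := fun e => v ∉ G.ends e) _ (by simp)]

end

end Multigraph

/-! ### Pairings and coefficient extraction -/

namespace Finset

/-- A set of unordered pairs of distinct elements that covers every element exactly once. -/
def IsPairing {D : Type*} (P : Finset (Sym2 D)) : Prop :=
  (∀ p ∈ P, ¬ p.IsDiag) ∧ ∀ e : D, ∃! p, p ∈ P ∧ e ∈ p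

end Finset

namespace Sym2

variable {D R : Type*}

open Classical in
/-- How often an element occurs in an unordered pair. -/
noncomputable def mult (e : D) : Sym2 D → ℕ :=
  Sym2.lift ⟨fun a b => (if e = a then 1 else 0) + (if e = b then 1 else 0),
    fun _ _ => add_comm _ _⟩

/-- The product of a function over the two elements of an unordered pair. -/
def pairProd [CommMonoid R] (y : D → R) : Sym2 D → R :=
  Sym2.lift ⟨fun a b => y a * y b, fun _ _ => mul_comm _ _⟩

@[simp]
theorem pairProd_mk [CommMonoid R] (y : D → R) (a b : D) : pairProd y s(a, b) = y a * y b :=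
  rfl

open Classical in
theorem mult_mk (e a b : D) :
    mult e s(a, b) = (if e = a then 1 else 0) + (if e = b then 1 else 0) :=
  rfl

theorem mult_eq_zero_iff {e : D} {p : Sym2 D} : mult e p = 0 ↔ e ∉ p := by
  induction p with
  | _ a b => classical simp [mult_mk]

theorem mult_eq_one {e : D} {p : Sym2 D} (he : e ∈ p) (hp : ¬ p.IsDiag) : mult e p = 1 := by
  induction p with
  | _ a b =>
    classical
    rw [Sym2.mk_isDiag_iff] at hp
    rcases Sym2.mem_iff.1 he with rfl | rfl
    · simp [mult_mk, hp]
    · simp [mult_mk, Ne.symm hp]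

theorem mult_self (e : D) : mult e s(e, e) = 2 := by
  simp [mult_mk]

theorem prod_pow_mult [CommMonoid R] [Fintype D] (y : D → R) (p : Sym2 D) :
    ∏ e, y e ^ mult e p = pairProd y p := by
  classical
  induction p with
  | _ a b =>
    have h : ∀ c e : D, y e ^ (if e = c then 1 else 0) = if e = c then y c else 1 := by
      intro c e
      split_ifs with h
      · rw [h, pow_one]
      · rw [pow_zero]
    simp only [mult_mk, pow_add, Finset.prod_mul_distrib, h]
    simp

end Sym2

namespace Finset

variable {D R : Type*}

open Classical in
/-- The exponent vector of a squarefree monomial. -/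
noncomputable def indicatorExp {ρ : Type*} [Finite ρ] (P : Finset ρ) : ρ →₀ ℕ :=
  Finsupp.equivFunOnFinite.symm fun p => if p ∈ P then 1 else 0

theorem indicatorExp_apply {ρ : Type*} [Finite ρ] (P : Finset ρ) (p : ρ) [Decidable (p ∈ P)] :
    indicatorExp P p = if p ∈ P then 1 else 0 := by
  simp only [indicatorExp, Finsupp.equivFunOnFinite_symm_apply_apply]
  congr

theorem IsPairing.sum_mult [Fintype D] {P : Finset (Sym2 D)} (hP : P.IsPairing) (e : D) :
    ∑ p ∈ P, Sym2.mult e p = 1 := by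
  obtain ⟨p, ⟨hp, hep⟩, huniq⟩ := hP.2 e
  rw [Finset.sum_eq_single_of_mem p hp, Sym2.mult_eq_one hep (hP.1 p hp)]
  intro q hq hqp
  rw [Sym2.mult_eq_zero_iff]
  exact fun heq => hqp (huniq q ⟨hq, heq⟩)

theorem IsPairing.prod_pairProd [CommMonoid R] [Fintype D] {P : Finset (Sym2 D)}
    (hP : P.IsPairing) (y : D → R) : ∏ p ∈ P, Sym2.pairProd y p = ∏ e, y e := by
  simp_rw [← Sym2.prod_pow_mult]
  rw [Finset.prod_comm]
  refine Finset.prod_congr rfl fun e _ => ?_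
  rw [Finset.prod_pow_eq_pow_sum, hP.sum_mult, pow_one]

open Classical in
-- The left side says that the monomial with exponents `α` in the pairs becomes the product of all
-- `y_e` after substituting `y_e * y_f` for each pair. A diagonal pair would contribute `2` to its
-- element, and two pairs sharing an element would contribute at least `2` as well.
theorem sum_mult_mul_eq_one_iff [Fintype D] [Fintype (Sym2 D)] (α : Sym2 D → ℕ) :
    (∀ e, ∑ p, α p * Sym2.mult e p = 1) ↔
      ∃ P : Finset (Sym2 D), P.IsPairing ∧ α = ⇑(indicatorExp P) := by
  constructor
  · intro h
    have hle : ∀ e p, α p * Sym2.mult e p ≤ 1 := fun e p =>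
      (h e) ▸ Finset.single_le_sum (f := fun p => α p * Sym2.mult e p) (fun _ _ => Nat.zero_le _)
        (Finset.mem_univ p)
    have hnd : ∀ p, α p ≠ 0 → ¬ p.IsDiag := by
      intro p
      induction p with
      | _ a b =>
        intro hp hab
        rw [Sym2.mk_isDiag_iff] at hab
        subst hab
        have := hle a s(a, a)
        rw [Sym2.mult_self] at this
        omega
    refine ⟨Finset.univ.filter fun p => α p ≠ 0, ⟨?_, ?_⟩, ?_⟩
    · intro p hp
      exact hnd p (by simpa using hp)
    · intro e
      have hne : ∑ p, α p * Sym2.mult e p ≠ 0 := by rw [h e]; exact one_ne_zero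
      obtain ⟨p, -, hp⟩ := Finset.exists_ne_zero_of_sum_ne_zero hne
      have hp1 : α p ≠ 0 := left_ne_zero_of_mul hp
      have hp2 : e ∈ p := by
        by_contra hc
        exact right_ne_zero_of_mul hp (Sym2.mult_eq_zero_iff.2 hc)
      refine ⟨p, ⟨by simpa using hp1, hp2⟩, ?_⟩
      rintro q ⟨hq, heq⟩
      by_contra hqp
      have hq1 : α q * Sym2.mult e q ≠ 0 :=
        mul_ne_zero (by simpa using hq) (fun hc => Sym2.mult_eq_zero_iff.1 hc heq)
      have h3 : α p * Sym2.mult e p + α q * Sym2.mult e q ≤ 1 := by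
        rw [← h e, ← Finset.sum_pair (f := fun p => α p * Sym2.mult e p) (Ne.symm hqp)]
        exact Finset.sum_le_sum_of_subset (Finset.subset_univ _)
      omega
    · ext p
      rw [indicatorExp_apply]
      by_cases hp : α p = 0
      · simp [hp]
      · have : ∃ e, e ∈ p := ⟨_, Sym2.out_fst_mem p⟩
        obtain ⟨e, he⟩ := this
        have h4 := hle e p
        rw [Sym2.mult_eq_one he (hnd p hp), mul_one] at h4
        have : α p = 1 := by omega
        simp [this]
  · rintro ⟨P, hP, rfl⟩ e
    simp only [indicatorExp_apply, ite_mul, one_mul, zero_mul, Finset.sum_ite_mem,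
      Finset.univ_inter]
    exact hP.sum_mult e

end Finset

namespace MvPolynomial

variable {R D ρ : Type*} [CommRing R]

/-- Setting the variables outside `P` to zero keeps exactly the monomials supported in `P`. In this
way a coefficient for a single transition is isolated from a polynomial in all pairs. -/
theorem topCoeff_aeval_kill [Fintype ρ] (P : Finset ρ) [DecidablePred (· ∈ P)]
    (F : MvPolynomial ρ R) :
    topCoeff (aeval (fun p => if h : p ∈ P then X ⟨p, h⟩ else 0) F :
      MvPolynomial {p // p ∈ P} R) =
      F.coeff (Finset.indicatorExp P) := by
  refine eq_of_forall_prod_X_pow (R := R) (σ := ρ) (A := R) (fun F => topCoeff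
    (aeval (fun p => if h : p ∈ P then (X ⟨p, h⟩ : MvPolynomial {p // p ∈ P} R) else 0) F))
    (fun F => F.coeff (Finset.indicatorExp P)) ?_ ?_ ?_ F
  · intro p q
    simp only [map_add, topCoeff_add]
  · intro p q
    exact coeff_add _ _ _
  · intro c α
    simp only [map_mul, map_prod, map_pow, aeval_X, aeval_C, algebraMap_eq, topCoeff_C_mul,
      coeff_C_mul]
    congr 1
    have hdec : DecidableEq (ρ → ℕ) := Classical.decEq _
    have hdec' : DecidableEq ({p // p ∈ P} → ℕ) := Classical.decEq _
    rw [coeff_univ_prod_X_pow']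
    by_cases h : ∀ p, p ∉ P → α p = 0
    · have h1 : (∏ p, (if h : p ∈ P then (X ⟨p, h⟩ : MvPolynomial {p // p ∈ P} R) else 0) ^ α p) =
          ∏ p : {p // p ∈ P}, X p ^ α p := by
        rw [← Finset.prod_subset (Finset.subset_univ P)]
        · rw [← Finset.prod_coe_sort P]
          refine Finset.prod_congr rfl fun p _ => ?_
          rw [dif_pos p.2]
        · intro p _ hp
          rw [h p hp, pow_zero]
      rw [h1, topCoeff, coeff_univ_prod_X_pow]
      refine if_congr ?_ rfl rfl
      constructor
      · intro h2
        ext p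
        rw [Finset.indicatorExp_apply]
        split_ifs with hp
        · exact congrFun h2 ⟨p, hp⟩
        · exact h p hp
      · rintro h2
        ext p
        simp [h2, Finset.indicatorExp_apply]
    · push Not at h
      obtain ⟨p, hp, hα⟩ := h
      rw [Finset.prod_eq_zero (Finset.mem_univ p) (by rw [dif_neg hp, zero_pow hα])]
      rw [if_neg]
      · simp [topCoeff]
      · intro h2
        rw [h2] at hα
        simp [hp, Finset.indicatorExp_apply] at hα

/-- Summing the coefficients of all perfect matchings amounts to the substitution of `y_e * y_f`
for the variable of each pair `{e, f}`. -/
theorem sum_coeff_pairing {T : Type*} [Fintype T] [Fintype D] [Fintype (Sym2 D)]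
    (ε : T ≃ {P : Finset (Sym2 D) // P.IsPairing}) (F : MvPolynomial (Sym2 D) R) :
    ∑ t, F.coeff (Finset.indicatorExp (ε t).1) =
      topCoeff (aeval (Sym2.pairProd X) F : MvPolynomial D R) := by
  classical
  have : Fintype {P : Finset (Sym2 D) // P.IsPairing} := Fintype.ofEquiv T ε
  rw [ε.sum_comp fun P => F.coeff (Finset.indicatorExp P.1)]
  refine eq_of_forall_prod_X_pow (fun F => ∑ P : {P : Finset (Sym2 D) // P.IsPairing},
      F.coeff (Finset.indicatorExp P.1))
      (fun F => topCoeff (aeval (Sym2.pairProd X) F : MvPolynomial D R)) ?_ ?_ ?_ F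
  · intro p q
    simp only [coeff_add, Finset.sum_add_distrib]
  · intro p q
    simp only [map_add, topCoeff_add]
  · intro c α
    simp only [map_mul, map_prod, map_pow, aeval_X, aeval_C, algebraMap_eq, topCoeff_C_mul,
      coeff_C_mul, coeff_univ_prod_X_pow', ← Finset.mul_sum]
    congr 1
    have h1 : (∏ p, Sym2.pairProd (X : D → MvPolynomial D R) p ^ α p) =
        ∏ e, X e ^ ∑ p, α p * Sym2.mult e p := by
      simp_rw [← Sym2.prod_pow_mult, ← Finset.prod_pow, ← pow_mul, mul_comm (Sym2.mult _ _)]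
      rw [Finset.prod_comm]
      simp_rw [Finset.prod_pow_eq_pow_sum]
    rw [h1, topCoeff, coeff_univ_prod_X_pow]
    by_cases h : ∃ P : Finset (Sym2 D), P.IsPairing ∧ α = ⇑(Finset.indicatorExp P)
    · rw [if_pos (_root_.funext ((Finset.sum_mult_mul_eq_one_iff α).2 h))]
      obtain ⟨P, hP, hα⟩ := h
      rw [Finset.sum_eq_single_of_mem ⟨P, hP⟩ (Finset.mem_univ _), if_pos hα]
      rintro ⟨Q, hQ⟩ _ hQP
      rw [if_neg]
      rintro h2
      apply hQP
      ext p
      have := congrFun (hα.symm.trans h2) p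
      simp only [Finset.indicatorExp_apply] at this ⊢
      by_cases h3 : p ∈ P <;> by_cases h4 : p ∈ Q <;> simp_all
    · rw [if_neg (fun h2 => h ((Finset.sum_mult_mul_eq_one_iff α).1 (congrFun h2)))]
      refine Finset.sum_eq_zero fun P _ => ?_
      rw [if_neg]
      exact fun h2 => h ⟨P.1, P.2, h2⟩

end MvPolynomial

/-! ### Degrees, resolved graphs and vanishing for loops -/

namespace Sym2

variable {D D' : Type*}

open Classical in
theorem mult_eq (e : D) (p : Sym2 D) :
    mult e p = (if e ∈ p then 1 else 0) + (if p = s(e, e) then 1 else 0) := by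
  induction p with
  | _ a b =>
    have h : s(a, b) = s(e, e) ↔ e = a ∧ e = b := by
      rw [Sym2.eq_iff]
      constructor
      · rintro (⟨h1, h2⟩ | ⟨h1, h2⟩) <;> exact ⟨by simp_all, by simp_all⟩
      · rintro ⟨h1, h2⟩; exact Or.inl ⟨h1.symm, h2.symm⟩
    rw [mult_mk, if_congr h rfl rfl, if_congr Sym2.mem_iff rfl rfl]
    by_cases h1 : e = a <;> by_cases h2 : e = b <;> simp [h1, h2, add_comm]

theorem sum_mult_univ [Fintype D] (p : Sym2 D) : ∑ e, mult e p = 2 := by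
  induction p with
  | _ a b => classical simp [mult_mk, Finset.sum_add_distrib]

theorem mult_map_injective {θ : D → D'} (hθ : Function.Injective θ) (e : D) (p : Sym2 D) :
    mult (θ e) (p.map θ) = mult e p := by
  induction p with
  | _ a b =>
    classical
    have h : ∀ x y : D, (if θ x = θ y then 1 else 0) = if x = y then 1 else 0 :=
      fun x y => if_congr hθ.eq_iff rfl rfl
    rw [Sym2.map_mk, mult_mk, mult_mk, h, h]

open Classical in
theorem mult_map [Fintype D] (θ : D → D') (u : D') (p : Sym2 D) :
    mult u (p.map θ) = ∑ e, mult e p * if θ e = u then 1 else 0 := by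
  induction p with
  | _ a b =>
    simp only [mult_mk, add_mul, Finset.sum_add_distrib, Sym2.map_mk, ite_mul, one_mul, zero_mul]
    simp [eq_comm]

end Sym2

namespace Multigraph

open MvPolynomial

variable {V : Type u} {E : Type w}

theorem degree_eq_sum [Fintype E] (G : Multigraph V E) (v : V) :
    G.degree v = ∑ e, Sym2.mult v (G.ends e) := by
  classical
  simp only [Sym2.mult_eq, Finset.sum_add_distrib, Finset.sum_boole, Nat.cast_id]
  rw [degree, Nat.card_eq_fintype_card, Nat.card_eq_fintype_card, Fintype.card_subtype,
    Fintype.card_subtype]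

theorem sum_degree [Fintype V] [Fintype E] (G : Multigraph V E) :
    ∑ v, G.degree v = 2 * Fintype.card E := by
  simp_rw [degree_eq_sum]
  rw [Finset.sum_comm]
  simp [Sym2.sum_mult_univ, mul_comm]

theorem IsRegular.card_edges [Finite V] [Finite E] {G : Multigraph V E} {k : ℕ}
    (hG : G.IsRegular (2 * k)) : Nat.card E = k * Nat.card V := by
  have := Fintype.ofFinite V
  have := Fintype.ofFinite E
  have h := G.sum_degree
  rw [Finset.sum_congr rfl fun v _ => hG v] at h
  simp only [Finset.sum_const, Finset.card_univ, smul_eq_mul] at h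
  rw [Nat.card_eq_fintype_card, Nat.card_eq_fintype_card]
  nlinarith

theorem NoLoopAt.card_edgesAt [Finite E] {G : Multigraph V E} {v : V} (hv : G.NoLoopAt v) :
    Nat.card (G.EdgesAt v) = G.degree v := by
  have : IsEmpty {e : E // G.ends e = s(v, v)} := ⟨fun e => hv e.1 e.2⟩
  rw [degree, Nat.card_of_isEmpty (α := {e : E // G.ends e = s(v, v)}), add_zero]

theorem card_edgesAt_add [Finite E] (G : Multigraph V E) (v : V) :
    Nat.card (G.EdgesAt v) + Nat.card {e : E // v ∉ G.ends e} = Nat.card E := by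
  classical
  rw [← Nat.card_sum]
  exact Nat.card_congr (Equiv.sumCompl fun e => v ∈ G.ends e)

theorem card_ne_add_one [Finite V] (v : V) : Nat.card {x : V // x ≠ v} + 1 = Nat.card V := by
  classical
  have := Fintype.ofFinite V
  rw [Nat.card_eq_fintype_card, Nat.card_eq_fintype_card, Fintype.card_subtype_compl]
  simp only [Fintype.card_unique]
  have : 0 < Fintype.card V := Fintype.card_pos_iff.2 ⟨v⟩
  omega

theorem ends_eq_of_edgesAt (G : Multigraph V E) (v : V) (e : G.EdgesAt v) :
    G.ends e.1 = s(v, G.neighbour v e) :=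
  (Sym2.other_spec e.2).symm

theorem deleteVertex_ends_map (G : Multigraph V E) (v : V) (e : {e : E // v ∉ G.ends e}) :
    ((G.deleteVertex v).ends e).map Subtype.val = G.ends e.1 := by
  simp [deleteVertex, Sym2.attachWith_map_subtypeVal]

theorem mem_deleteVertex_ends {G : Multigraph V E} {v : V} {e : {e : E // v ∉ G.ends e}}
    {u : {x : V // x ≠ v}} : u ∈ (G.deleteVertex v).ends e ↔ u.1 ∈ G.ends e.1 := by
  rw [← deleteVertex_ends_map G v e, Sym2.mem_map]
  constructor
  · intro h; exact ⟨u, h, rfl⟩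
  · rintro ⟨x, hx, hxu⟩; rwa [← Subtype.ext hxu]

theorem resolve_ends_inr_map (G : Multigraph V E) (v : V) (hv : G.NoLoopAt v)
    (τ : G.Transition v) (p : {p // p ∈ τ.1}) :
    ((G.resolve v hv τ).ends (Sum.inr p)).map Subtype.val = p.1.map (G.neighbour v) := by
  simp only [resolve, Sum.elim_inr, Sym2.map_map]
  rfl

theorem mem_resolve_ends_inr {G : Multigraph V E} {v : V} {hv : G.NoLoopAt v}
    {τ : G.Transition v} {p : {p // p ∈ τ.1}} {u : {x : V // x ≠ v}} :
    u ∈ (G.resolve v hv τ).ends (Sum.inr p) ↔ u.1 ∈ p.1.map (G.neighbour v) := by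
  rw [← resolve_ends_inr_map G v hv τ p, Sym2.mem_map]
  constructor
  · intro h; exact ⟨u, h, rfl⟩
  · rintro ⟨x, hx, hxu⟩; rwa [← Subtype.ext hxu]

theorem isPairing_of_transition {G : Multigraph V E} {v : V} (τ : G.Transition v) :
    τ.1.IsPairing :=
  τ.2

/-- Each edge from `v` to `u` lies in exactly one pair of `τ`, which passes its end at `u` on to one
new edge; the edges away from `v` are unchanged. -/
theorem resolve_degree [Finite E] (G : Multigraph V E) (v : V) (hv : G.NoLoopAt v)
    (τ : G.Transition v) (u : {x : V // x ≠ v}) :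
    (G.resolve v hv τ).degree u = G.degree u.1 := by
  classical
  have := Fintype.ofFinite E
  rw [degree_eq_sum, degree_eq_sum, Fintype.sum_sum_type,
    ← (Equiv.sumCompl fun e => v ∈ G.ends e).sum_comp, Fintype.sum_sum_type, add_comm]
  congr 1
  · have h1 : ∀ p : {p // p ∈ τ.1}, Sym2.mult u ((G.resolve v hv τ).ends (Sum.inr p)) =
        ∑ e, Sym2.mult e p.1 * if G.neighbour v e = u.1 then 1 else 0 := by
      intro p
      rw [← Sym2.mult_map_injective Subtype.val_injective, resolve_ends_inr_map, Sym2.mult_map]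
    simp_rw [h1]
    rw [Finset.sum_comm]
    refine Finset.sum_congr rfl fun e _ => ?_
    rw [← Finset.sum_mul, Finset.sum_coe_sort τ.1 (fun p => Sym2.mult e p),
      (isPairing_of_transition τ).sum_mult e, one_mul]
    simp only [Equiv.sumCompl_apply_inl]
    rw [ends_eq_of_edgesAt, Sym2.mult_mk, if_neg u.2, zero_add]
    exact if_congr eq_comm rfl rfl
  · refine Finset.sum_congr rfl fun e _ => ?_
    rw [← Sym2.mult_map_injective Subtype.val_injective]
    simp only [resolve, Sum.elim_inl, Equiv.sumCompl_apply_inr]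
    rw [deleteVertex_ends_map]

theorem IsRegular.resolve [Finite E] {G : Multigraph V E} {d : ℕ} (hG : G.IsRegular d) (v : V)
    (hv : G.NoLoopAt v) (τ : G.Transition v) : (G.resolve v hv τ).IsRegular d :=
  fun u => (resolve_degree G v hv τ u).trans (hG u.1)

theorem kirchhoff_isHomogeneous [Fintype E] (G : Multigraph V E) :
    G.kirchhoff.IsHomogeneous (Nat.card V - 1) := by
  classical
  refine IsHomogeneous.sum _ _ _ fun T hT => ?_
  have hc : T.card = Nat.card V - 1 := by
    have := (Finset.mem_filter.1 hT).2.1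
    omega
  have := IsHomogeneous.prod T (fun e => (X e : MvPolynomial E ℤ)) (fun _ => 1)
    (fun e _ => isHomogeneous_X ℤ e)
  simpa [hc] using this

theorem topCoeff_kirchhoff_pow_eq_zero [Fintype E] (G : Multigraph V E) (k : ℕ)
    (h : Fintype.card E ≠ (Nat.card V - 1) * k) : topCoeff (G.kirchhoff ^ k) = 0 := by
  refine (G.kirchhoff_isHomogeneous.pow k).coeff_eq_zero ?_
  rw [Finsupp.degree_eq_sum]
  simpa using h

theorem coeff_aeval_ite_eq_zero {P : E → Prop} [DecidablePred P] (F : MvPolynomial E ℤ)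
    (s : E →₀ ℕ) {e : E} (he : P e) (hs : s e ≠ 0) :
    (aeval (fun e => if P e then 0 else (X e : MvPolynomial E ℤ)) F).coeff s = 0 := by
  classical
  induction F using MvPolynomial.induction_on' with
  | monomial a c =>
    rw [aeval_monomial, algebraMap_eq, coeff_C_mul]
    by_cases h : ∃ e', P e' ∧ a e' ≠ 0
    · obtain ⟨e', h1, h2⟩ := h
      rw [Finsupp.prod, Finset.prod_eq_zero (Finsupp.mem_support_iff.2 h2)
        (by rw [if_pos h1, zero_pow h2]), coeff_zero, mul_zero]
    · push Not at h
      have h1 : (a.prod fun i n => (if P i then 0 else (X i : MvPolynomial E ℤ)) ^ n) =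
          monomial a 1 := by
        rw [monomial_eq, C_1, one_mul]
        refine Finset.prod_congr rfl fun i hi => ?_
        simp only
        rw [if_neg fun hP => (Finsupp.mem_support_iff.1 hi) (h i hP)]
      rw [h1, coeff_monomial, if_neg, mul_zero]
      rintro rfl
      exact hs (h e he)
  | add p q hp hq => rw [map_add, coeff_add, hp, hq, add_zero]

/-- A loop contributes nothing to the Laplacian, so setting its variable to zero leaves the
Kirchhoff polynomial unchanged. -/
theorem diagonalCoeff_kirchhoff_pow_eq_zero [Finite V] [Fintype E] (G : Multigraph V E)
    {r : ℕ} (hr : r ≠ 0) (m : ℕ) {e : E} {a : V} (he : G.ends e = s(a, a)) :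
    diagonalCoeff r (G.kirchhoff ^ m) = 0 := by
  classical
  have := Fintype.ofFinite V
  have hja : Set.range (Subtype.val : {x : V // x ≠ a} → V) = {a}ᶜ := by ext; simp
  have h1 := G.aeval_kirchhoff Subtype.val_injective hja (X : E → MvPolynomial E ℤ)
  have h2 := G.aeval_kirchhoff Subtype.val_injective hja
    (fun e' => if e' = e then 0 else (X e' : MvPolynomial E ℤ))
  rw [aeval_X_left_apply] at h1
  have h3 : aeval (fun e' => if e' = e then 0 else (X e' : MvPolynomial E ℤ)) G.kirchhoff =
      G.kirchhoff := by
    refine h2.trans (Eq.trans ?_ h1.symm)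
    congr 1
    ext1 i i'
    simp only [Matrix.of_apply]
    refine Finset.sum_congr rfl fun e' _ => ?_
    split_ifs with h
    · rw [h, he, edgeLap_diag]; simp
    · rfl
  rw [← h3, ← map_pow]
  exact coeff_aeval_ite_eq_zero _ _ (P := fun e' => e' = e) rfl hr

/-- A loop away from `u` survives in `G \ u` and lies in no spanning tree. A loop at `u` uses up two
units of its degree, so fewer than `2k` edges are removed and `G \ u` has too many edges for `k`
trees. -/
theorem IsRegular.topCoeff_eq_zero_of_loop [Finite V] [Finite E] {G : Multigraph V E} {k : ℕ}
    (hG : G.IsRegular (2 * k)) (hn : 2 ≤ Nat.card V) {e : E} {a : V} (he : G.ends e = s(a, a))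
    (u : V) [Fintype {e : E // u ∉ G.ends e}] :
    topCoeff ((G.deleteVertex u).kirchhoff ^ k) = 0 := by
  classical
  by_cases hu : u = a
  · subst hu
    apply topCoeff_kirchhoff_pow_eq_zero
    have h1 := hG.card_edges
    have h2 := G.card_edgesAt_add u
    have h3 := card_ne_add_one u
    have h4 : Nat.card (G.EdgesAt u) < 2 * k := by
      have : 0 < Nat.card {e : E // G.ends e = s(u, u)} := by
        rw [Nat.card_pos_iff]
        exact ⟨⟨⟨e, he⟩⟩, inferInstance⟩
      have := hG u
      unfold degree at this
      unfold EdgesAt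
      omega
    rw [← Nat.card_eq_fintype_card]
    obtain ⟨n, hn'⟩ : ∃ n, Nat.card V = n + 2 := ⟨Nat.card V - 2, by omega⟩
    have h5 : Nat.card {x : V // x ≠ u} - 1 = n := by omega
    rw [h5]
    intro h6
    rw [h6, h1, hn'] at h2
    nlinarith
  · have h1 : u ∉ G.ends e := by
      rw [he]; simpa using hu
    have h2 : (G.deleteVertex u).ends ⟨e, h1⟩ = s(⟨a, fun h => hu h.symm⟩, ⟨a, fun h => hu h.symm⟩) := by
      apply Sym2.map.injective Subtype.val_injective
      rw [deleteVertex_ends_map]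
      exact he
    exact diagonalCoeff_kirchhoff_pow_eq_zero _ one_ne_zero k h2

end Multigraph

/-! ### The star-mesh transformation -/

namespace Matrix

variable {R I : Type*} [CommRing R] [Fintype I] [DecidableEq I]

/-- The Schur complement with cleared denominators: multiplication by a block triangular matrix with
diagonal blocks `1` and `Y • 1` kills the upper right block, so `Y` need not be invertible. -/
theorem det_fromBlocks_mul_pow (Y : R) (η : I → R) (M : Matrix I I R) :
    (fromBlocks (of fun _ _ : Unit => Y) (of fun _ i => -η i) (of fun i _ => -η i) M).det *
      Y ^ Fintype.card I = Y * (Y • M - of fun i j => η i * η j).det := by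
  have h : fromBlocks (of fun _ _ : Unit => Y) (of fun _ i => -η i) (of fun i _ => -η i) M *
      fromBlocks (1 : Matrix Unit Unit R) (of fun _ i => η i) 0 (Y • (1 : Matrix I I R)) =
      fromBlocks (of fun _ _ : Unit => Y) 0 (of fun i _ => -η i)
        (Y • M - of fun i j => η i * η j) := by
    rw [fromBlocks_multiply]
    congr 1
    · simp
    · ext i j
      simp [mul_apply]
    · simp
    · ext i j
      simp [mul_apply]
      ring
  have h2 := congrArg det h
  rw [det_mul, det_fromBlocks_zero₂₁, det_fromBlocks_zero₁₂] at h2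
  simpa using h2

end Matrix

theorem ite_congr_of_iff {α : Sort*} {P Q : Prop} {hP : Decidable P} {hQ : Decidable Q}
    (h : P ↔ Q) (a b : α) : (if P then a else b) = if Q then a else b :=
  if_congr h rfl rfl

namespace Sym2

theorem two_mul_sum_eq {D R : Type*} [CommRing R] [Fintype D] [Fintype (Sym2 D)]
    (F : Sym2 D → R) (hF : ∀ e, F s(e, e) = 0) :
    2 * ∑ p, F p = ∑ e, ∑ f, F s(e, f) := by
  classical
  rw [← Fintype.sum_prod_type' (f := fun e f => F s(e, f)), Finset.mul_sum,
    ← Finset.sum_fiberwise (s := Finset.univ) (g := fun x : D × D => s(x.1, x.2))]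
  refine Finset.sum_congr rfl fun p _ => ?_
  induction p with
  | _ a b =>
    have h1 : ∀ x ∈ Finset.univ.filter (fun x : D × D => s(x.1, x.2) = s(a, b)),
        F s(x.1, x.2) = F s(a, b) := fun x hx => by rw [(Finset.mem_filter.1 hx).2]
    rw [Finset.sum_congr rfl h1, Finset.sum_const]
    by_cases hab : a = b
    · subst hab; simp [hF]
    · have h2 : Finset.univ.filter (fun x : D × D => s(x.1, x.2) = s(a, b)) =
          {(a, b), (b, a)} := by
        ext ⟨x, y⟩
        simp
      rw [h2, Finset.card_pair (by simp [hab]), nsmul_eq_mul]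
      norm_num

end Sym2

namespace Multigraph

open MvPolynomial

variable {V : Type u} {E : Type w}

section StarMesh

variable {R : Type*} [CommRing R]

open Classical in
/-- A minor of the Laplacian matrix of the graph that arises if the star of `v` is replaced by a
mesh with an edge for every pair of edges at `v`; edges at `w` are dropped. -/
noncomputable def meshLap (G : Multigraph V E) (v w a : V)
    [Fintype {e : E // v ∉ G.ends e}] [Fintype (Sym2 (G.EdgesAt v))] (x : {e : E // v ∉ G.ends e} → R)
    (z : Sym2 (G.EdgesAt v) → R) :
    Matrix {u : V // u ≠ v ∧ u ≠ w ∧ u ≠ a} {u : V // u ≠ v ∧ u ≠ w ∧ u ≠ a} R :=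
  Matrix.of fun i j =>
    (∑ e, (if w ∈ G.ends e.1 then 0 else x e) * ((edgeLap (G.ends e.1) i j : ℤ) : R)) +
    ∑ p, (if w ∈ p.map (G.neighbour v) then 0 else z p) *
      ((edgeLap (p.map (G.neighbour v)) i j : ℤ) : R)

theorem map_meshLap {S : Type*} [CommRing S] (f : R →+* S) (G : Multigraph V E) (v w a : V)
    [Fintype {e : E // v ∉ G.ends e}] [Fintype (Sym2 (G.EdgesAt v))]
    (x : {e : E // v ∉ G.ends e} → R) (z : Sym2 (G.EdgesAt v) → R) :
    (G.meshLap v w a x z).map f = G.meshLap v w a (fun e => f (x e)) (fun p => f (z p)) := by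
  classical
  ext i j
  simp [meshLap, apply_ite f]

open Classical in
-- The new edges of `G_τ` join the same vertices as the mesh edges of the pairs in `τ`, so its
-- Laplacian is the mesh Laplacian with weight zero on all other pairs.
theorem aeval_kirchhoff_resolve_deleteVertex [Algebra ℤ R] [Fintype V]
    (G : Multigraph V E) {v w a : V} [Fintype {e : E // v ∉ G.ends e}]
    [Fintype (Sym2 (G.EdgesAt v))]
    (hv : G.NoLoopAt v) (hwv : w ≠ v) (hav : a ≠ v) (haw : a ≠ w) (τ : G.Transition v)
    [Fintype {e // (⟨w, hwv⟩ : {x : V // x ≠ v}) ∉ (G.resolve v hv τ).ends e}]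
    (x : {e : E // v ∉ G.ends e} → R) (y : {p // p ∈ τ.1} → R) :
    aeval (fun e => Sum.elim x y e.1)
      ((G.resolve v hv τ).deleteVertex ⟨w, hwv⟩).kirchhoff =
      (G.meshLap v w a x (fun p => if h : p ∈ τ.1 then y ⟨p, h⟩ else 0)).det := by
  let j : {u : V // u ≠ v ∧ u ≠ w ∧ u ≠ a} → {x : V // x ≠ v} := fun i => ⟨i.1, i.2.1⟩
  have hj : Function.Injective j := fun i i' h => Subtype.ext (congrArg (fun x => x.1) h)
  have hja : Set.range j = {⟨w, hwv⟩, ⟨a, hav⟩}ᶜ := by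
    ext ⟨x, hx⟩
    simp only [Set.mem_range, Set.mem_compl_iff, Set.mem_insert_iff, Set.mem_singleton_iff,
      Subtype.mk.injEq, not_or, j]
    constructor
    · rintro ⟨i, rfl⟩; exact i.2.2
    · intro h; exact ⟨⟨x, hx, h⟩, rfl⟩
  refine (aeval_kirchhoff_deleteVertex' (G.resolve v hv τ) hj
    (fun h => haw (congrArg Subtype.val h).symm) hja (Sum.elim x y)).trans ?_
  congr 1
  ext i i'
  simp only [Matrix.of_apply, meshLap, Fintype.sum_sum_type]
  congr 1
  · refine Finset.sum_congr rfl fun e _ => ?_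
    have h1 : (⟨w, hwv⟩ : {x : V // x ≠ v}) ∈ (G.resolve v hv τ).ends (Sum.inl e) ↔
        w ∈ G.ends e.1 := mem_deleteVertex_ends
    refine congrArg₂ (· * ·) (ite_congr_of_iff h1 _ _) ?_
    rw [← edgeLap_map Subtype.val_injective]
    simp only [resolve, Sum.elim_inl, deleteVertex_ends_map, j]
  · have h2 : ∀ p, (if w ∈ Sym2.map (G.neighbour v) p then 0 else if h : p ∈ τ.1 then y ⟨p, h⟩ else 0)
        * ((edgeLap (p.map (G.neighbour v)) i i' : ℤ) : R) = if h : p ∈ τ.1 then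
          (if w ∈ Sym2.map (G.neighbour v) p then 0 else y ⟨p, h⟩)
        * ((edgeLap (p.map (G.neighbour v)) i i' : ℤ) : R) else 0 := by
      intro p
      split_ifs <;> simp
    simp_rw [h2]
    rw [← Finset.sum_subset (Finset.subset_univ τ.1) (fun p _ hp => dif_neg hp),
      ← Finset.sum_coe_sort τ.1]
    refine Finset.sum_congr rfl fun p _ => ?_
    rw [dif_pos p.2]
    refine congrArg₂ (· * ·) (ite_congr_of_iff mem_resolve_ends_inr _ _) ?_
    rw [← edgeLap_map Subtype.val_injective, resolve_ends_inr_map]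

/-- The edges of a graph, split into those away from `v` and those at `v`. -/
noncomputable def splitEdges (G : Multigraph V E) (v : V) :
    E ≃ {e : E // v ∉ G.ends e} ⊕ G.EdgesAt v := by
  classical
  exact (Equiv.sumCompl fun e => v ∈ G.ends e).symm.trans (Equiv.sumComm _ _)

theorem splitEdges_symm_inl (G : Multigraph V E) (v : V) (e : {e : E // v ∉ G.ends e}) :
    (G.splitEdges v).symm (Sum.inl e) = e.1 := rfl

theorem splitEdges_symm_inr (G : Multigraph V E) (v : V) (e : G.EdgesAt v) :
    (G.splitEdges v).symm (Sum.inr e) = e.1 := rfl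

open Classical in
-- The row and column of `v` are singled out as the block to be eliminated. The weights `y'` discard
-- the edges from `v` to `w`, which are absent from `G \ w`.
theorem aeval_kirchhoff_deleteVertex_eq_fromBlocks [Algebra ℤ R] [Fintype E] [Fintype V]
    (G : Multigraph V E) {v w a : V} [Fintype {e : E // v ∉ G.ends e}] [Fintype (G.EdgesAt v)]
    [Fintype {e : E // w ∉ G.ends e}] (hv : G.NoLoopAt v) (hwv : w ≠ v) (hav : a ≠ v)
    (haw : a ≠ w) (x : {e : E // v ∉ G.ends e} → R) (y y' : G.EdgesAt v → R)
    (hy' : y' = fun d => if G.neighbour v d = w then 0 else y d) :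
    aeval (fun e => Sum.elim x y (G.splitEdges v e.1)) (G.deleteVertex w).kirchhoff =
      (Matrix.fromBlocks (Matrix.of fun _ _ : Unit => ∑ d, y' d)
        (Matrix.of fun _ (i : {u : V // u ≠ v ∧ u ≠ w ∧ u ≠ a}) =>
          -∑ d, y' d * if i.1 = G.neighbour v d then 1 else 0)
        (Matrix.of fun (i : {u : V // u ≠ v ∧ u ≠ w ∧ u ≠ a}) _ =>
          -∑ d, y' d * if i.1 = G.neighbour v d then 1 else 0)
        (Matrix.of fun i j => (∑ e, (if w ∈ G.ends e.1 then 0 else x e) *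
            ((edgeLap (G.ends e.1) i.1 j.1 : ℤ) : R)) +
          ∑ d, y' d * ((if i.1 = G.neighbour v d then 1 else 0) *
            (if j.1 = G.neighbour v d then 1 else 0)))).det := by
  let j : Unit ⊕ {u : V // u ≠ v ∧ u ≠ w ∧ u ≠ a} → V := Sum.elim (fun _ => v) Subtype.val
  have hj : Function.Injective j := by
    rintro (_ | i) (_ | i') h
    · rfl
    · exact absurd h.symm i'.2.1
    · exact absurd h i.2.1
    · exact congrArg _ (Subtype.ext h)
  have hja : Set.range j = {w, a}ᶜ := by
    ext x
    simp only [Set.mem_range, Set.mem_compl_iff, Set.mem_insert_iff, Set.mem_singleton_iff, not_or]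
    constructor
    · rintro ⟨_ | i, rfl⟩
      · exact ⟨hwv.symm, hav.symm⟩
      · exact i.2.2
    · intro h
      by_cases hx : x = v
      · exact ⟨Sum.inl (), hx.symm⟩
      · exact ⟨Sum.inr ⟨x, hx, h⟩, rfl⟩
  rw [aeval_kirchhoff_deleteVertex' G hj haw.symm hja
    (fun e => Sum.elim x y (G.splitEdges v e))]
  congr 1
  have hsum : ∀ i i', (∑ e, (if w ∈ G.ends e then 0 else Sum.elim x y (G.splitEdges v e)) *
      ((edgeLap (G.ends e) (j i) (j i') : ℤ) : R)) =
      (∑ e : {e : E // v ∉ G.ends e}, (if w ∈ G.ends e.1 then 0 else x e) *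
        ((edgeLap (G.ends e.1) (j i) (j i') : ℤ) : R)) +
      ∑ d, y' d * ((edgeLap s(v, G.neighbour v d) (j i) (j i') : ℤ) : R) := by
    intro i i'
    rw [← (G.splitEdges v).symm.sum_comp, Fintype.sum_sum_type]
    congr 1
    · refine Finset.sum_congr rfl fun e _ => ?_
      rw [Equiv.apply_symm_apply, Sum.elim_inl, splitEdges_symm_inl]
    · refine Finset.sum_congr rfl fun d _ => ?_
      rw [Equiv.apply_symm_apply, Sum.elim_inr, splitEdges_symm_inr, ends_eq_of_edgesAt, hy']
      have : w ∈ s(v, G.neighbour v d) ↔ G.neighbour v d = w := by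
        rw [Sym2.mem_iff]
        exact ⟨fun h => (h.resolve_left hwv).symm, fun h => Or.inr h.symm⟩
      rw [if_congr this rfl rfl]
  have hne : ∀ d, v ≠ G.neighbour v d := fun d => (G.neighbour_ne hv d).symm
  have hx0 : ∀ (e : {e : E // v ∉ G.ends e}) (i' : V), (if w ∈ G.ends e.1 then 0 else x e) *
      ((edgeLap (G.ends e.1) v i' : ℤ) : R) = 0 := by
    intro e i'
    rw [edgeLap_eq_zero_of_notMem e.2, Int.cast_zero, mul_zero]
  have hs0 : ∀ u i', (∑ e : {e : E // v ∉ G.ends e}, (if w ∈ G.ends e.1 then 0 else x e) *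
      ((edgeLap (G.ends e.1) (j (Sum.inl u)) i' : ℤ) : R)) = 0 :=
    fun u i' => Finset.sum_eq_zero fun e _ => hx0 e i'
  ext i i'
  rw [Matrix.of_apply, hsum]
  rcases i with _ | i <;> rcases i' with _ | i'
  · rw [hs0, zero_add]
    simp [edgeLap_mk, j, hne]
  · rw [hs0, zero_add]
    simp [edgeLap_mk, j, hne, i'.2.1]
  · simp_rw [edgeLap_comm _ (j (Sum.inr i))]
    rw [hs0, zero_add]
    simp [edgeLap_mk, j, hne, i.2.1]
  · simp only [Matrix.fromBlocks_apply₂₂, Matrix.of_apply]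
    congr 1
    refine Finset.sum_congr rfl fun d _ => ?_
    simp only [edgeLap_mk, j, Sum.elim_inr, i.2.1, i'.2.1, if_false]
    push_cast
    ring

open Classical in
/-- The star-mesh transformation of the Kirchhoff polynomial. -/
theorem aeval_kirchhoff_deleteVertex_mul_pow [Algebra ℤ R] [IsDomain R] [CharZero R] [Fintype E] [Fintype V]
    (G : Multigraph V E) {v w a : V} [Fintype {e : E // v ∉ G.ends e}] [Fintype (G.EdgesAt v)]
    [Fintype {e : E // w ∉ G.ends e}] (hv : G.NoLoopAt v) (hwv : w ≠ v) (hav : a ≠ v)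
    (haw : a ≠ w) [Fintype (Sym2 (G.EdgesAt v))] (x : {e : E // v ∉ G.ends e} → R)
    (y : G.EdgesAt v → R) (Y : R)
    (hY : Y = ∑ d with G.neighbour v d ≠ w, y d) :
    aeval (fun e => Sum.elim x y (G.splitEdges v e.1)) (G.deleteVertex w).kirchhoff *
      Y ^ Fintype.card {u : V // u ≠ v ∧ u ≠ w ∧ u ≠ a} =
      Y * (G.meshLap v w a (fun e => Y * x e) (Sym2.pairProd y)).det := by
  obtain ⟨y', hy'⟩ : ∃ y' : G.EdgesAt v → R,
    y' = fun d => if G.neighbour v d = w then 0 else y d := ⟨_, rfl⟩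
  have hYy : Y = ∑ d, y' d := by
    rw [hY, hy', Finset.sum_filter]
    refine Finset.sum_congr rfl fun d _ => ?_
    by_cases h : G.neighbour v d = w <;> simp [h]
  rw [aeval_kirchhoff_deleteVertex_eq_fromBlocks G hv hwv hav haw x y y' hy', ← hYy,
    Matrix.det_fromBlocks_mul_pow]
  congr 2
  ext i j
  set b : V → G.EdgesAt v → R := fun u d => if u = G.neighbour v d then 1 else 0 with hb
  have hmesh : (∑ p, (if w ∈ p.map (G.neighbour v) then 0 else Sym2.pairProd y p) *
      ((edgeLap (p.map (G.neighbour v)) i j : ℤ) : R)) =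
      Y * (∑ d, y' d * (b i d * b j d)) - (∑ d, y' d * b i d) * ∑ d, y' d * b j d := by
    -- Doubling turns the sum over unordered pairs into a sum over ordered pairs, which factors into
    -- products of single sums; diagonal pairs give loops and vanish.
    have h2 : (2 : R) ≠ 0 := two_ne_zero
    apply mul_left_cancel₀ h2
    rw [Sym2.two_mul_sum_eq _ (fun e => by rw [Sym2.map_mk, edgeLap_diag]; simp)]
    have h3 : ∀ e f, (if w ∈ s(e, f).map (G.neighbour v) then 0 else Sym2.pairProd y s(e, f)) *
        ((edgeLap (s(e, f).map (G.neighbour v)) i j : ℤ) : R) =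
        y' e * (b i e * b j e) * y' f - (y' e * b i e) * (y' f * b j f)
          - (y' e * b j e) * (y' f * b i f) + y' e * (y' f * (b i f * b j f)) := by
      intro e f
      have h4 : (if w ∈ s(e, f).map (G.neighbour v) then 0 else Sym2.pairProd y s(e, f)) =
          y' e * y' f := by
        have h7 : w ∈ s(e, f).map (G.neighbour v) ↔
            G.neighbour v e = w ∨ G.neighbour v f = w := by
          rw [Sym2.map_mk, Sym2.mem_iff, eq_comm, @eq_comm _ w]
        rw [if_congr h7 rfl rfl, hy', Sym2.pairProd_mk]
        by_cases h5 : G.neighbour v e = w <;> by_cases h6 : G.neighbour v f = w <;>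
          simp [h5, h6]
      rw [h4, Sym2.map_mk, edgeLap_mk]
      push_cast
      simp only [hb]
      ring
    simp_rw [h3, Finset.sum_add_distrib, Finset.sum_sub_distrib, ← Finset.mul_sum,
      ← Finset.sum_mul]
    rw [hYy]
    ring
  rw [meshLap, Matrix.of_apply, hmesh]
  simp only [Matrix.sub_apply, Matrix.smul_apply, Matrix.of_apply, smul_eq_mul, mul_add,
    Finset.mul_sum, hb]
  rw [add_sub_assoc]
  congr 1
  refine Finset.sum_congr rfl fun e _ => ?_
  split_ifs
  · simp
  · ring

end StarMesh

end Multigraph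

namespace Multigraph

open MvPolynomial

variable {V : Type u} {E : Type w}

/-- The variables of the edges at `u`, indexed by `s` and `t`, are missing from `G \ u`. Once they
are supplied as factors, the coefficient can be taken first in the variables of `σ` and then in
those of `ρ`. -/
theorem topCoeff_kirchhoff_deleteVertex_split [Fintype E] {σ ρ : Type*} [Fintype σ] [Fintype ρ]
    (G : Multigraph V E) (u : V) [Fintype {e : E // u ∉ G.ends e}] (ε : E ≃ σ ⊕ ρ) (k : ℕ)
    (s : Finset σ) (hs : ∀ i, i ∈ s ↔ u ∈ G.ends (ε.symm (Sum.inl i)))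
    (t : Finset ρ) (ht : ∀ i, i ∈ t ↔ u ∈ G.ends (ε.symm (Sum.inr i)))
    (Ψ : MvPolynomial σ (MvPolynomial ρ ℤ))
    (hΨ : aeval (fun e => Sum.elim X (fun r => C (X r)) (ε e.1)) (G.deleteVertex u).kirchhoff =
      Ψ) :
    topCoeff ((G.deleteVertex u).kirchhoff ^ k) =
      topCoeff (topCoeff (Ψ ^ k * ∏ i ∈ s, X i) * ∏ r ∈ t, X r) := by
  classical
  rw [← topCoeff_rename_mul_prod_X (P := fun e => u ∉ G.ends e),
    topCoeff_eq_topCoeff_topCoeff ε, map_mul, aeval_rename, map_pow, map_prod]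
  simp only [aeval_X]
  have h1 : (∏ e : {e : E // ¬ u ∉ G.ends e}, Sum.elim X (fun r => C (X r)) (ε e.1) :
      MvPolynomial σ (MvPolynomial ρ ℤ)) = (∏ i ∈ s, X i) * C (∏ r ∈ t, X r) := by
    have hs' : s = Finset.univ.filter fun i => u ∈ G.ends (ε.symm (Sum.inl i)) := by
      ext i; simp [hs]
    have ht' : t = Finset.univ.filter fun i => u ∈ G.ends (ε.symm (Sum.inr i)) := by
      ext i; simp [ht]
    rw [← Finset.prod_subtype (Finset.univ.filter fun e => u ∈ G.ends e) (by simp)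
      (fun e => Sum.elim X (fun r => C (X r)) (ε e)), Finset.prod_filter, ← ε.symm.prod_comp,
      Fintype.prod_sum_type, map_prod, hs', ht', Finset.prod_filter, Finset.prod_filter]
    simp
  rw [h1, ← hΨ, ← mul_assoc, mul_comm _ (C _), topCoeff_C_mul, mul_comm]
  rfl

open Classical in
theorem aeval_C_mul_X_det_meshLap [Fintype V] {S : Type*} [CommRing S] (G : Multigraph V E) (v w a : V)
    [Fintype {e : E // v ∉ G.ends e}] [Fintype (Sym2 (G.EdgesAt v))] (Y : S)
    (y : G.EdgesAt v → S) :
    aeval (fun e => (C Y * X e : MvPolynomial {e : E // v ∉ G.ends e} S))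
      (G.meshLap v w a X (Sym2.pairProd fun d => C (y d)) :
        Matrix _ _ (MvPolynomial {e : E // v ∉ G.ends e} S)).det =
      (G.meshLap v w a (fun e => C Y * X e) (Sym2.pairProd fun d => C (y d)) :
        Matrix _ _ (MvPolynomial {e : E // v ∉ G.ends e} S)).det := by
  have h := map_meshLap (aeval (fun e => (C Y * X e : MvPolynomial {e : E // v ∉ G.ends e} S)) :
    MvPolynomial {e : E // v ∉ G.ends e} S →ₐ[S] _).toRingHom G v w a X
      (Sym2.pairProd fun d => C (y d))
  rw [AlgHom.map_det, AlgHom.mapMatrix_apply]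
  refine congrArg Matrix.det (h.trans ?_)
  congr 1
  · funext e
    exact aeval_X _ _
  · funext p
    induction p with
    | _ d d' =>
      simp only [Sym2.pairProd_mk, AlgHom.toRingHom_eq_coe, RingHom.coe_coe, map_mul, aeval_C,
        algebraMap_eq]

section

variable [Fintype V]

theorem card_ne_three {v w a : V} (hwv : w ≠ v) (hav : a ≠ v) (haw : a ≠ w)
    [Fintype {u : V // u ≠ v ∧ u ≠ w ∧ u ≠ a}] :
    Fintype.card {u : V // u ≠ v ∧ u ≠ w ∧ u ≠ a} + 3 = Fintype.card V := by
  classical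
  have h : (Finset.univ.filter fun u => u ≠ v ∧ u ≠ w ∧ u ≠ a) = ({v, w, a} : Finset V)ᶜ := by
    ext; simp
  rw [Fintype.card_subtype, h, Finset.card_compl]
  have h3 : ({v, w, a} : Finset V).card = 3 := by
    rw [Finset.card_eq_three]
    exact ⟨v, w, a, hwv.symm, hav.symm, haw.symm, rfl⟩
  have := Finset.card_le_univ ({v, w, a} : Finset V)
  omega

open Classical in
/-- The star-mesh transformation for the part of the power of the Kirchhoff polynomial that is
linear in every edge away from `v`. -/
theorem topCoeff_star_mesh [Fintype E] {G : Multigraph V E} {k : ℕ} (hG : G.IsRegular (2 * k))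
    (hl : G.Loopless) {v w a : V} (hwv : w ≠ v) (hav : a ≠ v) (haw : a ≠ w)
    [Fintype {e : E // v ∉ G.ends e}] [Fintype (G.EdgesAt v)] [Fintype {e : E // w ∉ G.ends e}]
    [Fintype (Sym2 (G.EdgesAt v))] :
    topCoeff ((aeval (fun e => Sum.elim X (fun d => C (X d)) (G.splitEdges v e.1))
        (G.deleteVertex w).kirchhoff :
          MvPolynomial {e : E // v ∉ G.ends e} (MvPolynomial (G.EdgesAt v) ℤ)) ^ k *
          ∏ e : {e : E // v ∉ G.ends e} with w ∈ G.ends e.1, X e) =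
      (∑ d with G.neighbour v d ≠ w, X d) ^ Fintype.card {d // G.neighbour v d = w} *
      topCoeff ((G.meshLap v w a X (Sym2.pairProd fun d => C (X d)) :
          Matrix _ _ (MvPolynomial {e : E // v ∉ G.ends e}
            (MvPolynomial (G.EdgesAt v) ℤ))).det ^ k *
          ∏ e : {e : E // v ∉ G.ends e} with w ∈ G.ends e.1, X e) := by
  set Y : MvPolynomial (G.EdgesAt v) ℤ := ∑ d with G.neighbour v d ≠ w, X d with hY
  set Ψ : MvPolynomial {e : E // v ∉ G.ends e} (MvPolynomial (G.EdgesAt v) ℤ) :=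
    aeval (fun e => Sum.elim X (fun d => C (X d)) (G.splitEdges v e.1))
        (G.deleteVertex w).kirchhoff with hΨ
  set Δ := (G.meshLap v w a X (Sym2.pairProd fun d => C (X d)) : Matrix _ _ (MvPolynomial
    {e : E // v ∉ G.ends e} (MvPolynomial (G.EdgesAt v) ℤ))).det with hΔ
  set N : MvPolynomial {e : E // v ∉ G.ends e} (MvPolynomial (G.EdgesAt v) ℤ) :=
    ∏ e : {e : E // v ∉ G.ends e} with w ∈ G.ends e.1, X e with hN
  set m := Fintype.card {d // G.neighbour v d = w} with hm
  have hcardX : Fintype.card {e : E // v ∉ G.ends e} + 2 * k = k * Fintype.card V := by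
    have h1 := hG.card_edges
    have h2 := G.card_edgesAt_add v
    rw [(hl v).card_edgesAt, hG v] at h2
    rw [← Nat.card_eq_fintype_card, ← Nat.card_eq_fintype_card]
    omega
  have hcardI := card_ne_three hwv hav haw
  set c := (Finset.univ.filter fun e : {e : E // v ∉ G.ends e} => w ∈ G.ends e.1).card with hc
  -- The `2k` edges at `w` are the `c` edges that avoid `v` and the `m` edges that lead to `v`.
  have hcm : c + m = 2 * k := by
    rw [← hG w, ← (hl w).card_edgesAt, ← Nat.card_congr (Equiv.sumCompl fun e : G.EdgesAt w =>
      v ∉ G.ends e.1), Nat.card_sum, hc, hm, ← Fintype.card_subtype, Nat.card_eq_fintype_card,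
      Nat.card_eq_fintype_card]
    congr 1
    · refine Fintype.card_congr ⟨fun e => ⟨⟨e.1.1, e.2⟩, e.1.2⟩, fun e => ⟨⟨e.1.1, e.2⟩, e.1.2⟩,
        fun _ => rfl, fun _ => rfl⟩
    · have hiff : ∀ d : G.EdgesAt v, G.neighbour v d = w ↔ w ∈ G.ends d.1 := by
        intro d
        rw [ends_eq_of_edgesAt, Sym2.mem_iff]
        exact ⟨fun h => Or.inr h.symm, fun h => (h.resolve_left hwv).symm⟩
      refine Fintype.card_congr ⟨fun d => ⟨⟨d.1.1, (hiff d.1).1 d.2⟩, not_not.2 d.1.2⟩,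
        fun e => ⟨⟨e.1.1, not_not.1 e.2⟩, (hiff _).2 e.1.2⟩, fun _ => rfl, fun _ => rfl⟩
  -- If every edge at `v` leads to `w`, then `Y = 0` cannot be cancelled. In that case both sides
  -- vanish, because `v` is isolated in `G \ w`, unless `k = 0`, where all powers are trivial.
  by_cases hD : ∀ d, G.neighbour v d = w
  · rcases Nat.eq_zero_or_pos k with hk | hk
    · have hm0 : m = 0 := by omega
      rw [hk, hm0, pow_zero, pow_zero, pow_zero, one_mul, one_mul]
    · have hY0 : Y = 0 := by
        rw [hY]
        exact Finset.sum_eq_zero fun d hd => absurd (hD d) (Finset.mem_filter.1 hd).2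
      have hm0 : m ≠ 0 := by
        have h1 : Nat.card (G.EdgesAt v) = 2 * k := by rw [(hl v).card_edgesAt, hG v]
        have h2 : m = Nat.card (G.EdgesAt v) := by
          rw [Nat.card_eq_fintype_card, hm]
          exact Fintype.card_congr (Equiv.subtypeUnivEquiv hD)
        omega
      have hΨ0 : Ψ = 0 := by
        rw [hΨ, aeval_kirchhoff_deleteVertex_eq_fromBlocks G (hl v) hwv hav haw
          (X : _ → MvPolynomial {e : E // v ∉ G.ends e} (MvPolynomial (G.EdgesAt v) ℤ))
          (fun d => C (X d)) (fun _ => 0) (by funext d; simp [hD d])]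
        refine Matrix.det_eq_zero_of_row_eq_zero (Sum.inl ()) ?_
        rintro (_ | i) <;> simp
      rw [hΨ0, hY0, zero_pow hk.ne', zero_pow hm0, zero_mul, zero_mul]
      rfl
  · have hY0 : Y ≠ 0 := by
      push Not at hD
      obtain ⟨d, hd⟩ := hD
      intro h0
      have h1 := congrArg (eval fun _ => (1 : ℤ)) h0
      rw [hY, map_sum, map_zero] at h1
      simp only [eval_X, Finset.sum_const, nsmul_eq_mul, mul_one, Nat.cast_eq_zero,
        Finset.card_eq_zero] at h1
      exact (Finset.eq_empty_iff_forall_notMem.1 h1 d) (by simpa using hd)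
    have hstar : Ψ * C Y ^ Fintype.card {u : V // u ≠ v ∧ u ≠ w ∧ u ≠ a} =
        C Y * aeval (fun e => C Y * X e) Δ := by
      rw [hΨ, aeval_kirchhoff_deleteVertex_mul_pow G (hl v) hwv hav haw X (fun d => C (X d)) (C Y)
        (by rw [hY, map_sum]), hΔ]
      rw [aeval_C_mul_X_det_meshLap]
    have hNs : aeval (fun e => C Y * X e) N = C Y ^ c * N := by
      rw [hN, map_prod]
      simp only [aeval_X, Finset.prod_mul_distrib, Finset.prod_const]
      rfl
    have hpow : C (Y ^ (Fintype.card {u : V // u ≠ v ∧ u ≠ w ∧ u ≠ a} * k + c)) * (Ψ ^ k * N) =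
        C (Y ^ k) * aeval (fun e => C Y * X e) (Δ ^ k * N) := by
      simp only [map_mul, map_pow, hNs]
      rw [show C Y ^ k * ((aeval (fun e => C Y * X e) Δ) ^ k * (C Y ^ c * N)) =
        (C Y * (aeval (fun e => C Y * X e) Δ)) ^ k * (C Y ^ c * N) by ring, ← hstar]
      ring
    have htop := congrArg topCoeff hpow
    rw [topCoeff_C_mul, topCoeff_C_mul, topCoeff_aeval_C_mul_X, ← mul_assoc, ← pow_add] at htop
    set n' := Fintype.card {u : V // u ≠ v ∧ u ≠ w ∧ u ≠ a}
    -- With `n` vertices, `n' = n - 3` and there are `k(n - 2)` edges away from `v`; as `c + m =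
    -- 2k`, both sides equal `k(n - 1)`. Hence exactly `Y ^ m` is left after cancellation.
    have hexp : k + Fintype.card {e : E // v ∉ G.ends e} = n' * k + c + m := by
      rw [← hcardI] at hcardX
      have : k * (n' + 3) = n' * k + 3 * k := by ring
      omega
    rw [hexp, pow_add _ (n' * k + c) m, mul_assoc] at htop
    exact mul_left_cancel₀ (pow_ne_zero _ hY0) htop

end

end Multigraph

/-! ### The recursion for tree coefficients -/

namespace Finset

variable {D R : Type*}

open Classical in
theorem IsPairing.sum_filter_not [AddCommMonoid R] [Fintype D] {P : Finset (Sym2 D)}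
    (hP : P.IsPairing)
    (κ : Sym2 D → R) (hκ : ∀ p ∉ P, κ p = 0) (W : D → Prop) {a b : D} (hab : s(a, b) ∈ P) :
    ∑ f with ¬ W f, κ s(a, f) = if W b then 0 else κ s(a, b) := by
  have h : ∀ f, f ≠ b → κ s(a, f) = 0 := by
    intro f hf
    apply hκ
    intro hfP
    obtain ⟨p, -, huniq⟩ := hP.2 a
    have h1 := huniq _ ⟨hab, Sym2.mem_mk_left a b⟩
    have h2 := huniq _ ⟨hfP, Sym2.mem_mk_left a f⟩
    exact hf (Sym2.congr_right.1 (h2.trans h1.symm))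
  rw [Finset.sum_filter, Finset.sum_eq_single b]
  · split_ifs <;> simp_all
  · intro f _ hf
    rw [h f hf, ite_self]
  · simp

open Classical in
-- Since `κ` vanishes off `P`, each inner sum selects the partner of `d`. As no pair lies entirely
-- in `W`, every pair that meets `W` is obtained once.
theorem IsPairing.prod_sum_filter_not [CommRing R] [Fintype D] {P : Finset (Sym2 D)}
    (hP : P.IsPairing) (κ : Sym2 D → R) (hκ : ∀ p ∉ P, κ p = 0) (W : D → Prop)
    (hW : ∀ p ∈ P, ∃ e ∈ p, ¬ W e) :
    ∏ d with W d, ∑ f with ¬ W f, κ s(d, f) = ∏ p ∈ P with ∃ e ∈ p, W e, κ p := by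
  rw [Finset.prod_filter, ← hP.prod_pairProd, Finset.prod_filter]
  refine Finset.prod_congr rfl fun p hp => ?_
  induction p with
  | _ a b =>
    rw [Sym2.pairProd_mk, hP.sum_filter_not κ hκ W hp,
      hP.sum_filter_not κ hκ W (Sym2.eq_swap ▸ hp)]
    have h1 : (∃ e ∈ s(a, b), W e) ↔ W a ∨ W b := by simp
    have h2 : ¬ (W a ∧ W b) := by
      rintro ⟨ha, hb⟩
      obtain ⟨e, he, hWe⟩ := hW _ hp
      rcases Sym2.mem_iff.1 he with rfl | rfl
      · exact hWe ha
      · exact hWe hb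
    rw [if_congr h1 rfl rfl]
    by_cases ha : W a <;> by_cases hb : W b <;> simp_all [Sym2.eq_swap]

open Classical in
theorem IsPairing.prod_sum_filter_not_eq_zero [CommRing R] [Fintype D] {P : Finset (Sym2 D)}
    (hP : P.IsPairing) (κ : Sym2 D → R) (hκ : ∀ p ∉ P, κ p = 0) (W : D → Prop)
    {p : Sym2 D} (hp : p ∈ P) (hW : ∀ e ∈ p, W e) :
    ∏ d with W d, ∑ f with ¬ W f, κ s(d, f) = 0 := by
  induction p with
  | _ a b =>
    have ha : W a := hW a (Sym2.mem_mk_left a b)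
    have hb : W b := hW b (Sym2.mem_mk_right a b)
    exact Finset.prod_eq_zero (Finset.mem_filter.2 ⟨Finset.mem_univ a, ha⟩)
      (by rw [hP.sum_filter_not κ hκ W hp, if_pos hb])

end Finset

namespace Multigraph

open MvPolynomial

variable {V : Type u} {E : Type w}

open Classical in
/-- The part of the `k`-th power of `meshLap` that is linear in all edges away from `v`, with a
variable for each pair of edges at `v`. -/
noncomputable def meshPoly [Fintype V] [Fintype E] (G : Multigraph V E) (v w a : V) (k : ℕ) :
    MvPolynomial (Sym2 (G.EdgesAt v)) ℤ :=
  topCoeff ((G.meshLap v w a X (fun p => C (X p)) :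
    Matrix _ _ (MvPolynomial {e : E // v ∉ G.ends e}
      (MvPolynomial (Sym2 (G.EdgesAt v)) ℤ))).det ^ k *
    ∏ e : {e : E // v ∉ G.ends e} with w ∈ G.ends e.1, X e)

open Classical in
theorem map_meshPoly [Fintype V] [Fintype E] {S : Type*} [CommRing S] (G : Multigraph V E)
    (v w a : V) (k : ℕ) (f : MvPolynomial (Sym2 (G.EdgesAt v)) ℤ →+* S) :
    f (G.meshPoly v w a k) = topCoeff ((G.meshLap v w a X (fun p => C (f (X p))) :
      Matrix _ _ (MvPolynomial {e : E // v ∉ G.ends e} S)).det ^ k *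
        ∏ e : {e : E // v ∉ G.ends e} with w ∈ G.ends e.1, X e) := by
  rw [meshPoly, ← topCoeff_map, map_mul, map_pow, map_prod, RingHom.map_det,
    RingHom.mapMatrix_apply, map_meshLap]
  simp only [map_X, map_C]

open Classical in
-- The product of sums does not depend on `τ`, but at the coefficient of `τ` it supplies exactly the
-- variables of the new edges at `w`, which are missing from `G_τ \ w`. This uniformity is what
-- allows the summation over all transitions.
theorem topCoeff_kirchhoff_resolve [Fintype V] [Fintype E] {G : Multigraph V E} {k : ℕ}
    (hG : G.IsRegular (2 * k)) {v w a : V} (hv : G.NoLoopAt v) (hwv : w ≠ v) (hav : a ≠ v)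
    (haw : a ≠ w) (τ : G.Transition v)
    [Fintype {e // (⟨w, hwv⟩ : {x : V // x ≠ v}) ∉ (G.resolve v hv τ).ends e}] :
    topCoeff (((G.resolve v hv τ).deleteVertex ⟨w, hwv⟩).kirchhoff ^ k) =
      (G.meshPoly v w a k * ∏ d with G.neighbour v d = w,
        ∑ f with ¬ G.neighbour v f = w, X s(d, f)).coeff
        (Finset.indicatorExp τ.1) := by
  set κ : MvPolynomial (Sym2 (G.EdgesAt v)) ℤ →ₐ[ℤ] MvPolynomial {p // p ∈ τ.1} ℤ :=
    aeval (fun p => if h : p ∈ τ.1 then X ⟨p, h⟩ else 0) with hκdef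
  have hτ := isPairing_of_transition τ
  have hκ : ∀ p ∉ τ.1, κ (X p) = 0 := by
    intro p hp
    rw [hκdef, aeval_X, dif_neg hp]
  have hkill := topCoeff_aeval_kill τ.1 (G.meshPoly v w a k * ∏ d with G.neighbour v d = w,
        ∑ f with ¬ G.neighbour v f = w, X s(d, f))
  refine Eq.trans ?_ hkill
  change _ = topCoeff (κ _)
  rw [map_mul, map_prod]
  simp_rw [map_sum]
  -- A pair of two edges that both lead to `w` makes a loop in `G_τ`; then both sides are zero.
  by_cases hgood : ∀ p ∈ τ.1, ∃ e ∈ p, ¬ G.neighbour v e = w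
  · rw [hτ.prod_sum_filter_not (fun p => κ (X p)) hκ _ hgood]
    have hm := G.map_meshPoly v w a k κ.toRingHom
    simp only [AlgHom.toRingHom_eq_coe, RingHom.coe_coe] at hm
    rw [hm]
    have h := G.aeval_kirchhoff_resolve_deleteVertex hv hwv hav haw τ
      (X : _ → MvPolynomial {e : E // v ∉ G.ends e} (MvPolynomial {p // p ∈ τ.1} ℤ))
      (fun p => C (X p))
    have hz : (fun p => if h : p ∈ τ.1 then C (X ⟨p, h⟩) else 0 : Sym2 (G.EdgesAt v) →
        MvPolynomial {e : E // v ∉ G.ends e} (MvPolynomial {p // p ∈ τ.1} ℤ)) =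
        fun p => C (κ (X p)) := by
      funext p
      rw [hκdef, aeval_X]
      split_ifs <;> simp
    rw [hz] at h
    have hinl : ∀ e, w ∈ G.ends e.1 ↔
        (⟨w, hwv⟩ : {x : V // x ≠ v}) ∈ (G.resolve v hv τ).ends (Sum.inl e) :=
      fun e => (mem_deleteVertex_ends (u := ⟨w, hwv⟩)).symm
    have hinr : ∀ p : {p // p ∈ τ.1}, (∃ e ∈ p.1, G.neighbour v e = w) ↔
        (⟨w, hwv⟩ : {x : V // x ≠ v}) ∈ (G.resolve v hv τ).ends (Sum.inr p) :=
      fun p => ((mem_resolve_ends_inr (hv := hv) (u := ⟨w, hwv⟩)).trans Sym2.mem_map).symm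
    have hsplit := topCoeff_kirchhoff_deleteVertex_split (σ := {e : E // v ∉ G.ends e})
      (ρ := {p // p ∈ τ.1}) (G.resolve v hv τ) ⟨w, hwv⟩ (Equiv.refl _) k
      (Finset.univ.filter fun e => w ∈ G.ends e.1)
      (fun e => by rw [Finset.mem_filter, and_iff_right (Finset.mem_univ e)]
                   exact hinl e)
      (Finset.univ.filter fun p => ∃ e ∈ p.1, G.neighbour v e = w)
      (fun p => by rw [Finset.mem_filter, and_iff_right (Finset.mem_univ p)]
                   exact hinr p) _ h
    rw [hsplit]
    congr 2
    rw [Finset.prod_filter, Finset.prod_filter, ← Finset.prod_coe_sort τ.1]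
    refine Finset.prod_congr rfl fun p _ => ?_
    have h2 : κ (X p.1) = X p := by rw [hκdef, aeval_X, dif_pos p.2]
    rw [h2]
    exact ite_congr_of_iff Iff.rfl _ _
  · push Not at hgood
    obtain ⟨p, hp, hpw⟩ := hgood
    rw [hτ.prod_sum_filter_not_eq_zero (fun p => κ (X p)) hκ _ hp hpw, mul_zero]
    have hloop : (G.resolve v hv τ).ends (Sum.inr ⟨p, hp⟩) = s(⟨w, hwv⟩, ⟨w, hwv⟩) := by
      apply Sym2.map.injective Subtype.val_injective
      rw [resolve_ends_inr_map]
      induction p with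
      | _ d f =>
        rw [Sym2.map_mk, Sym2.map_mk, hpw d (Sym2.mem_mk_left _ _), hpw f (Sym2.mem_mk_right _ _)]
    have hn : 2 ≤ Nat.card {x : V // x ≠ v} := by
      have : Nontrivial {x : V // x ≠ v} :=
        ⟨⟨⟨w, hwv⟩, ⟨a, hav⟩, fun h => haw (congrArg Subtype.val h).symm⟩⟩
      exact Finite.one_lt_card
    rw [(hG.resolve v hv τ).topCoeff_eq_zero_of_loop hn hloop]
    simp [topCoeff]

open Classical in
/-- The recursion of the Martin invariant for the diagonal coefficients of the Kirchhoff
polynomial. -/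
theorem sum_topCoeff_kirchhoff_resolve [Fintype V] [Fintype E] {G : Multigraph V E} {k : ℕ}
    (hG : G.IsRegular (2 * k)) (hl : G.Loopless) (hn : 3 ≤ Fintype.card V) {v w : V}
    (hwv : w ≠ v) [Fintype (G.Transition v)] [Fintype {e : E // w ∉ G.ends e}]
    [∀ τ, Fintype {e // (⟨w, hwv⟩ : {x : V // x ≠ v}) ∉ (G.resolve v (hl v) τ).ends e}] :
    ∑ τ : G.Transition v,
      topCoeff (((G.resolve v (hl v) τ).deleteVertex ⟨w, hwv⟩).kirchhoff ^ k) =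
      topCoeff ((G.deleteVertex w).kirchhoff ^ k) := by
  obtain ⟨a, ha⟩ : ∃ a, a ∉ ({v, w} : Finset V) := by
    by_contra! h
    have h1 : Fintype.card V ≤ ({v, w} : Finset V).card :=
      Finset.card_le_card fun x _ => h x
    have := Finset.card_le_two (a := v) (b := w)
    omega
  simp only [Finset.mem_insert, Finset.mem_singleton, not_or] at ha
  obtain ⟨hav, haw⟩ := ha
  simp_rw [topCoeff_kirchhoff_resolve hG (hl v) hwv hav haw]
  let ε : G.Transition v ≃ {P : Finset (Sym2 (G.EdgesAt v)) // P.IsPairing} := Equiv.refl _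
  have hsum := sum_coeff_pairing ε (G.meshPoly v w a k * ∏ d with G.neighbour v d = w,
        ∑ f with ¬ G.neighbour v f = w, X s(d, f))
  refine hsum.trans ?_
  have hfilter : ∀ d : G.EdgesAt v, w ∈ G.ends d.1 ↔ G.neighbour v d = w := by
    intro d
    rw [ends_eq_of_edgesAt, Sym2.mem_iff]
    exact ⟨fun h => (h.resolve_left hwv).symm, fun h => Or.inr h.symm⟩
  rw [topCoeff_kirchhoff_deleteVertex_split G w (G.splitEdges v) k
    (Finset.univ.filter fun e => w ∈ G.ends e.1)
    (fun e => by rw [Finset.mem_filter, and_iff_right (Finset.mem_univ e), splitEdges_symm_inl])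
    (Finset.univ.filter fun d => G.neighbour v d = w)
    (fun d => by rw [Finset.mem_filter, and_iff_right (Finset.mem_univ d), splitEdges_symm_inr,
      hfilter]) _ rfl]
  congr 1
  rw [map_mul, map_prod]
  -- After the substitution the extra factor becomes the product of the `y_d` with `d` leading to
  -- `w`, times one `Y` for each such `d`: the missing variables of `G \ w` and the power of `Y`
  -- from the star-mesh transformation.
  simp_rw [map_sum, aeval_X, Sym2.pairProd_mk, ← Finset.mul_sum, Finset.prod_mul_distrib]
  have hm := G.map_meshPoly v w a k (aeval (Sym2.pairProd X) :
    MvPolynomial (Sym2 (G.EdgesAt v)) ℤ →ₐ[ℤ] MvPolynomial (G.EdgesAt v) ℤ).toRingHom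
  simp only [AlgHom.toRingHom_eq_coe, RingHom.coe_coe, aeval_X] at hm
  rw [hm]
  have hs := topCoeff_star_mesh hG hl hwv hav haw
  have hpp : (fun p : Sym2 (G.EdgesAt v) => (C (Sym2.pairProd X p) :
      MvPolynomial {e : E // v ∉ G.ends e} (MvPolynomial (G.EdgesAt v) ℤ))) =
      Sym2.pairProd fun d => C (X d) := by
    funext p
    induction p with
    | _ d f => simp
  rw [hpp]
  rw [hs, Finset.prod_const, ← Fintype.card_subtype]
  ring

end Multigraph

/-! ### Existence and uniqueness of the Martin invariant -/

namespace MvPolynomial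

variable {R σ : Type*} [CommRing R]

theorem topCoeff_sum_X_pow [Fintype σ] (m : ℕ) :
    topCoeff ((∑ i, (X i : MvPolynomial σ R)) ^ m) =
      if m = Fintype.card σ then (m ! : R) else 0 := by
  classical
  rw [Finset.sum_pow_eq_sum_piAntidiag, topCoeff_sum]
  have h : ∀ a : σ → ℕ, topCoeff ((Nat.multinomial Finset.univ a : MvPolynomial σ R) *
      ∏ i, X i ^ a i) = if a = fun _ => 1 then (Nat.multinomial Finset.univ a : R) else 0 := by
    intro a
    rw [← map_natCast (C : R →+* MvPolynomial σ R), topCoeff_C_mul, topCoeff,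
      coeff_univ_prod_X_pow]
    split_ifs <;> simp
  simp_rw [h]
  rw [Finset.sum_ite_eq']
  simp only [Finset.mem_piAntidiag, Finset.sum_const, Finset.card_univ, smul_eq_mul, mul_one,
    ne_eq, one_ne_zero, not_false_eq_true, Finset.mem_univ, implies_true, and_true]
  by_cases hm : m = Fintype.card σ
  · rw [if_pos hm.symm, if_pos hm, Nat.multinomial]
    simp [hm]
  · rw [if_neg (Ne.symm hm), if_neg hm]

end MvPolynomial

namespace Multigraph

open MvPolynomial

variable {V : Type u} {E : Type w}

/-- The number of partitions of the edges of `G \ v` into `k` labelled spanning trees, as a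
coefficient of the Kirchhoff polynomial. -/
noncomputable def treeCoeff [Finite E] (G : Multigraph V E) (v : V) (k : ℕ) : ℤ :=
  letI := Fintype.ofFinite {e : E // v ∉ G.ends e}
  topCoeff ((G.deleteVertex v).kirchhoff ^ k)

theorem topCoeff_eq_treeCoeff [Finite E] (G : Multigraph V E) (v : V) (k : ℕ)
    [h : Fintype {e : E // v ∉ G.ends e}] :
    topCoeff ((G.deleteVertex v).kirchhoff ^ k) = G.treeCoeff v k := by
  rw [treeCoeff]
  congr!

theorem IsRegular.treeCoeff_eq_zero [Finite V] [Finite E] {G : Multigraph V E} {k : ℕ}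
    (hG : G.IsRegular (2 * k)) (hn : 2 ≤ Nat.card V) (hl : ¬ G.Loopless) (v : V) :
    G.treeCoeff v k = 0 := by
  have := Fintype.ofFinite {e : E // v ∉ G.ends e}
  simp only [Loopless, NoLoopAt, not_forall, not_not] at hl
  obtain ⟨a, e, he⟩ := hl
  rw [← topCoeff_eq_treeCoeff]
  exact hG.topCoeff_eq_zero_of_loop hn he v

theorem IsRegular.sum_treeCoeff_resolve [Finite V] [Finite E] {G : Multigraph V E} {k : ℕ}
    (hG : G.IsRegular (2 * k)) (hl : G.Loopless) (hn : 3 ≤ Nat.card V) {v w : V}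
    (hwv : w ≠ v) [Fintype (G.Transition v)] :
    ∑ τ : G.Transition v, (G.resolve v (hl v) τ).treeCoeff ⟨w, hwv⟩ k = G.treeCoeff w k := by
  have := Fintype.ofFinite V
  have := Fintype.ofFinite E
  have := Fintype.ofFinite {e : E // w ∉ G.ends e}
  have : ∀ τ, Fintype {e // (⟨w, hwv⟩ : {x : V // x ≠ v}) ∉ (G.resolve v (hl v) τ).ends e} :=
    fun τ => Fintype.ofFinite _
  rw [Nat.card_eq_fintype_card] at hn
  simp_rw [← topCoeff_eq_treeCoeff]
  exact sum_topCoeff_kirchhoff_resolve hG hl hn hwv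

theorem Loopless.treeCoeff_of_card_eq_two [Finite E] {G : Multigraph V E} (hl : G.Loopless)
    (hn : Nat.card V = 2) (v : V) (k : ℕ) : G.treeCoeff v k = 1 := by
  classical
  have : Finite V := Nat.finite_of_card_ne_zero (by omega)
  have := Fintype.ofFinite {e : E // v ∉ G.ends e}
  have h1 := card_ne_add_one v
  obtain ⟨a, ha⟩ := Nat.card_eq_one_iff_exists.1 (show Nat.card {x : V // x ≠ v} = 1 by omega)
  have hV : ∀ x : V, x ≠ v → x = a.1 := fun x hx => congrArg Subtype.val (ha ⟨x, hx⟩)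
  have hE : IsEmpty {e : E // v ∉ G.ends e} := by
    constructor
    rintro ⟨e, he⟩
    apply hl a.1 e
    generalize G.ends e = s at he
    induction s with
    | _ x y =>
      simp only [Sym2.mem_iff, not_or] at he
      rw [hV x (Ne.symm he.1), hV y (Ne.symm he.2)]
  have hk : (G.deleteVertex v).kirchhoff = 1 := by
    have h2 := aeval_kirchhoff_deleteVertex G (j := (Empty.elim : Empty → V))
      (fun x => x.elim) a.2.symm (by
        ext x
        simp only [Set.mem_range, IsEmpty.exists_iff, Set.mem_compl_iff, Set.mem_insert_iff,
          Set.mem_singleton_iff, false_iff, not_not]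
        by_cases hx : x = v
        · exact Or.inl hx
        · exact Or.inr (hV x hx)) (X : _ → MvPolynomial {e : E // v ∉ G.ends e} ℤ)
    rw [aeval_X_left_apply] at h2
    rw [h2, Matrix.det_isEmpty]
  rw [← topCoeff_eq_treeCoeff, hk, one_pow]
  have := topCoeff_prod_X (R := ℤ) (σ := {e : E // v ∉ G.ends e})
  simpa using this

theorem Loopless.treeCoeff_of_card_eq_three [Finite E] {G : Multigraph V E} {k : ℕ}
    (hl : G.Loopless) (hG : G.IsRegular (2 * k)) (hn : Nat.card V = 3) (v : V) :
    G.treeCoeff v k = k ! := by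
  classical
  have : Finite V := Nat.finite_of_card_ne_zero (by omega)
  have := Fintype.ofFinite V
  have := Fintype.ofFinite {e : E // v ∉ G.ends e}
  have h1 := card_ne_add_one v
  have h2 : Nat.card {x : V // x ≠ v} = 2 := by omega
  obtain ⟨a, b, hab, hun⟩ := Nat.card_eq_two_iff.1 h2
  have hV : ∀ x : V, x ≠ v → x = a.1 ∨ x = b.1 := fun x hx => by
    have : (⟨x, hx⟩ : {x : V // x ≠ v}) ∈ ({a, b} : Set _) := hun ▸ Set.mem_univ _
    rcases this with h | h
    · exact Or.inl (congrArg Subtype.val h)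
    · exact Or.inr (congrArg Subtype.val h)
  have hab' : a.1 ≠ b.1 := fun h => hab (Subtype.ext h)
  have hE : ∀ e : {e : E // v ∉ G.ends e}, G.ends e.1 = s(a.1, b.1) := by
    rintro ⟨e, he⟩
    have hla := hl a.1 e
    have hlb := hl b.1 e
    simp only
    generalize G.ends e = s at he hla hlb
    induction s with
    | _ x y =>
      simp only [Sym2.mem_iff, not_or] at he
      rcases hV x (Ne.symm he.1) with rfl | rfl <;> rcases hV y (Ne.symm he.2) with h | h <;>
        simp_all [Sym2.eq_swap]
  have hcard : Fintype.card {e : E // v ∉ G.ends e} = k := by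
    have h3 := G.card_edgesAt_add v
    have h4 := hG.card_edges
    rw [(hl v).card_edgesAt, hG v, h4, hn] at h3
    rw [← Nat.card_eq_fintype_card]
    omega
  have hk : (G.deleteVertex v).kirchhoff = ∑ e, X e := by
    have h5 := aeval_kirchhoff_deleteVertex G (j := (fun _ => b.1 : Unit → V))
      (fun _ _ _ => rfl) a.2.symm (by
        ext x
        simp only [Set.mem_range, exists_const, Set.mem_compl_iff, Set.mem_insert_iff,
          Set.mem_singleton_iff, not_or]
        constructor
        · rintro rfl; exact ⟨b.2, hab'.symm⟩
        · rintro ⟨hx1, hx2⟩; exact ((hV x hx1).resolve_left hx2).symm)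
          (X : _ → MvPolynomial {e : E // v ∉ G.ends e} ℤ)
    rw [aeval_X_left_apply] at h5
    rw [h5, Matrix.det_unique, Matrix.of_apply]
    refine Finset.sum_congr rfl fun e _ => ?_
    rw [hE e, edgeLap_mk]
    simp [hab'.symm]
  rw [← topCoeff_eq_treeCoeff, hk, topCoeff_sum_X_pow, if_pos hcard.symm]

/-- The rules for the Martin invariant produce exactly one value, which is given by a coefficient
of a power of the Kirchhoff polynomial. -/
theorem IsRegular.hasMartinInvariant_iff {k : ℕ} (n : ℕ) :
    ∀ {V : Type u} {E : Type w} [Finite E] {G : Multigraph V E}, G.IsRegular (2 * k) →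
      Nat.card V = n → 2 ≤ n → ∀ (v : V) (q : ℚ),
      HasMartinInvariant k G q ↔ q = (G.treeCoeff v k : ℚ) / (k ! : ℚ) := by
  induction n with
  | zero => intro V E _ G _ _ h; omega
  | succ n ih =>
    intro V E _ G hG hn hn2 v q
    have : Finite V := Nat.finite_of_card_ne_zero (by omega)
    have := Fintype.ofFinite V
    have hk0 : (k ! : ℚ) ≠ 0 := by positivity
    by_cases hl : G.Loopless
    · rcases Nat.lt_or_ge (n + 1) 4 with hlt | hge
      · rcases (by omega : n + 1 = 2 ∨ n + 1 = 3) with h | h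
        · rw [hl.treeCoeff_of_card_eq_two (hn.trans h), Int.cast_one]
          constructor
          · intro hq
            cases hq <;> first | rfl | contradiction | omega
          · rintro rfl
            exact HasMartinInvariant.two G (hn.trans h) hl
        · rw [hl.treeCoeff_of_card_eq_three hG (hn.trans h), Int.cast_natCast, div_self hk0]
          constructor
          · intro hq
            cases hq <;> first | rfl | contradiction | omega
          · rintro rfl
            exact HasMartinInvariant.three G (hn.trans h) hl
      · have hres : ∀ (x : V) (τ : G.Transition x) (y : {z : V // z ≠ x}) (q : ℚ),
            HasMartinInvariant k (G.resolve x (hl x) τ) q ↔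
              q = ((G.resolve x (hl x) τ).treeCoeff y k : ℚ) / (k ! : ℚ) := by
          intro x τ y q
          refine ih (hG.resolve x (hl x) τ) ?_ (by omega) y q
          have := card_ne_add_one x
          omega
        have hstep : ∀ (x y : V) (hyx : y ≠ x) [Fintype (G.Transition x)],
            ∑ τ : G.Transition x,
              ((G.resolve x (hl x) τ).treeCoeff ⟨y, hyx⟩ k : ℚ) / (k ! : ℚ) =
            (G.treeCoeff y k : ℚ) / (k ! : ℚ) := by
          intro x y hyx _
          rw [← Finset.sum_div, ← Int.cast_sum, hG.sum_treeCoeff_resolve hl (by omega) hyx]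
        have hother : ∀ x y : V, ∃ z, z ≠ x ∧ z ≠ y := by
          classical
          intro x y
          by_contra! h
          have h1 : Fintype.card V ≤ ({x, y} : Finset V).card := by
            refine Finset.card_le_card fun z _ => ?_
            by_cases hz : z = x
            · simp [hz]
            · simp [h z hz]
          have := Finset.card_le_two (a := x) (b := y)
          rw [Nat.card_eq_fintype_card] at hn
          omega
        -- Independence of the deleted vertex: resolve a third vertex `z`. By induction the
        -- coefficients of each `G_τ` for `x` and for `y` both give its unique value, and the sums
        -- over `τ` recover the two sides.
        have hconst : ∀ x y : V, (G.treeCoeff x k : ℚ) / (k ! : ℚ) =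
            (G.treeCoeff y k : ℚ) / (k ! : ℚ) := by
          intro x y
          obtain ⟨z, hzx, hzy⟩ := hother x y
          have : Finite (G.Transition z) := by unfold Transition; infer_instance
          have := Fintype.ofFinite (G.Transition z)
          rw [← hstep z x hzx.symm, ← hstep z y hzy.symm]
          refine Finset.sum_congr rfl fun τ _ => ?_
          rw [← hres z τ ⟨y, hzy.symm⟩, hres z τ ⟨x, hzx.symm⟩]
        constructor
        · intro hq
          cases hq with
          | loop _ _ hG' => exact absurd hl hG'
          | two _ hn' hG' => omega
          | three _ hn' hG' => omega
          | recursion _ hn' hG' x m hm =>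
            obtain ⟨y, hyx, -⟩ := hother x x
            rw [hconst v y, ← hstep x y hyx]
            exact Finset.sum_congr rfl fun τ _ => (hres x τ ⟨y, hyx⟩ _).1 (hm τ)
        · rintro rfl
          obtain ⟨x, hxv, -⟩ := hother v v
          have : Finite (G.Transition x) := by unfold Transition; infer_instance
          have := Fintype.ofFinite (G.Transition x)
          rw [← hstep x v hxv.symm]
          exact HasMartinInvariant.recursion G (by omega) hl x _
            fun τ => (hres x τ ⟨v, hxv.symm⟩ _).2 rfl
    · rw [hG.treeCoeff_eq_zero (by omega) hl, Int.cast_zero, zero_div]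
      constructor
      · intro hq
        cases hq <;> first | rfl | contradiction
      · rintro rfl
        exact HasMartinInvariant.loop G (by omega) hl

end Multigraph

/-! ### Duplicated edges -/

namespace MvPolynomial

variable {R σ ρ : Type*} [CommRing R]

open Classical in
-- By the multinomial theorem the squarefree monomial in the variables of `e` occurs only in the
-- power with exponent `Fintype.card ρ`, with the factorial of that exponent as coefficient.
theorem topCoeff_prod_sum_X_pow [Fintype σ] [Fintype ρ] (a : σ → ℕ) :
    topCoeff (∏ e, (∑ i, (X (e, i) : MvPolynomial (σ × ρ) R)) ^ a e) =
      if a = fun _ => Fintype.card ρ then ((Fintype.card ρ) ! : R) ^ Fintype.card σ else 0 := by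
  have h1 : ∀ e, (∑ i, (X (e, i) : MvPolynomial (σ × ρ) R)) ^ a e =
      ∑ c ∈ Finset.univ.piAntidiag (a e), (Nat.multinomial Finset.univ c : MvPolynomial (σ × ρ) R) *
        ∏ i, X (e, i) ^ c i := fun e => Finset.sum_pow_eq_sum_piAntidiag _ _ _
  simp_rw [h1]
  rw [Finset.prod_univ_sum, topCoeff_sum]
  have h2 : ∀ c : σ → ρ → ℕ, topCoeff (∏ e, ((Nat.multinomial Finset.univ (c e) :
      MvPolynomial (σ × ρ) R) * ∏ i, X (e, i) ^ c e i)) =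
      if c = fun _ _ => 1 then ((Fintype.card ρ) ! : R) ^ Fintype.card σ else 0 := by
    intro c
    have h3 : (∏ e, ∏ i, (X (e, i) : MvPolynomial (σ × ρ) R) ^ c e i) =
        ∏ x : σ × ρ, X x ^ (c x.1 x.2) :=
      (Fintype.prod_prod_type (fun x : σ × ρ => (X x : MvPolynomial (σ × ρ) R) ^ c x.1 x.2)).symm
    have h4 : (fun x : σ × ρ => c x.1 x.2) = (fun _ => 1) ↔ c = fun _ _ => 1 :=
      ⟨fun h => _root_.funext fun e => _root_.funext fun i => congrFun h (e, i), fun h => by rw [h]⟩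
    rw [Finset.prod_mul_distrib, h3]
    simp_rw [← map_natCast (C : R →+* MvPolynomial (σ × ρ) R)]
    rw [← map_prod, topCoeff_C_mul, topCoeff, coeff_univ_prod_X_pow, if_congr h4 rfl rfl]
    split_ifs with h
    · rw [h, Finset.prod_const, mul_one, Finset.card_univ, Nat.multinomial]
      simp
    · rw [mul_zero]
  simp_rw [h2]
  rw [Finset.sum_ite_eq']
  refine if_congr ?_ rfl rfl
  rw [Fintype.mem_piFinset]
  simp only [Finset.mem_piAntidiag, Finset.sum_const, Finset.card_univ, smul_eq_mul, mul_one,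
    ne_eq, one_ne_zero, not_false_eq_true, Finset.mem_univ, implies_true, and_true]
  exact ⟨fun h => _root_.funext fun e => (h e).symm, fun h e => by rw [h]⟩

theorem topCoeff_aeval_sum_X [Fintype σ] [Fintype ρ] (F : MvPolynomial σ R) :
    topCoeff (aeval (fun e => ∑ i, (X (e, i) : MvPolynomial (σ × ρ) R)) F) =
      ((Fintype.card ρ) ! : R) ^ Fintype.card σ *
        F.coeff (Finsupp.equivFunOnFinite.symm fun _ => Fintype.card ρ) := by
  classical
  refine eq_of_forall_prod_X_pow (R := R) (σ := σ) (A := R)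
    (fun F => topCoeff (aeval (fun e => ∑ i, (X (e, i) : MvPolynomial (σ × ρ) R)) F))
    (fun F => ((Fintype.card ρ) ! : R) ^ Fintype.card σ *
        F.coeff (Finsupp.equivFunOnFinite.symm fun _ => Fintype.card ρ)) ?_ ?_ ?_ F
  · intro p q
    simp only [map_add, topCoeff_add]
  · intro p q
    simp only [coeff_add, mul_add]
  · intro c a
    simp only [map_mul, map_prod, map_pow, aeval_X, aeval_C, algebraMap_eq, topCoeff_C_mul,
      coeff_C_mul, coeff_univ_prod_X_pow, topCoeff_prod_sum_X_pow]
    split_ifs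
    · ring
    · ring

end MvPolynomial

namespace Multigraph

open MvPolynomial

variable {V : Type u} {E : Type w}

theorem IsRegular.duplicate [Finite E] {G : Multigraph V E} {k : ℕ} (hG : G.IsRegular (2 * k))
    (r : ℕ) : (G.duplicate r).IsRegular (2 * (k * r)) := by
  have := Fintype.ofFinite E
  intro v
  have h := hG v
  rw [degree_eq_sum] at h ⊢
  rw [Fintype.sum_prod_type, ← mul_assoc, ← h, Finset.sum_mul]
  refine Finset.sum_congr rfl fun e _ => ?_
  simp [Multigraph.duplicate, mul_comm]

/-- Parallel edges have equal Laplacians, so the Kirchhoff polynomial of the duplication arises by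
substituting for `x_e` the sum of the variables of its `r` copies. -/
theorem treeCoeff_duplicate [Finite V] [Finite E] (G : Multigraph V E) (hn : 2 ≤ Nat.card V)
    (v : V) (k r : ℕ) [Fintype {e : E // v ∉ G.ends e}] :
    (G.duplicate r).treeCoeff v k = (r ! : ℤ) ^ Nat.card {e : E // v ∉ G.ends e} *
      diagonalCoeff r ((G.deleteVertex v).kirchhoff ^ k) := by
  classical
  have := Fintype.ofFinite V
  have : Fintype {e : E × Fin r // v ∉ (G.duplicate r).ends e} := Fintype.ofFinite _
  have : Nontrivial V := Finite.one_lt_card_iff_nontrivial.1 hn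
  obtain ⟨a, ha⟩ := exists_ne v
  let ε : {e : E × Fin r // v ∉ (G.duplicate r).ends e} ≃ {e : E // v ∉ G.ends e} × Fin r :=
    Equiv.prodSubtypeFstEquivSubtypeProd (p := fun e => v ∉ G.ends e)
  have hja : Set.range (Subtype.val : {x : V // x ≠ v ∧ x ≠ a} → V) = {v, a}ᶜ := by
    ext; simp
  have hkir : rename ε ((G.duplicate r).deleteVertex v).kirchhoff =
      aeval (fun e => ∑ i, (X (e, i) : MvPolynomial ({e : E // v ∉ G.ends e} × Fin r) ℤ))
        (G.deleteVertex v).kirchhoff := by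
    have h1 := aeval_kirchhoff_deleteVertex (G.duplicate r) Subtype.val_injective ha.symm hja
      (fun e => (X (ε e) : MvPolynomial ({e : E // v ∉ G.ends e} × Fin r) ℤ))
    have h2 := aeval_kirchhoff_deleteVertex G Subtype.val_injective ha.symm hja
      (fun e => ∑ i, (X (e, i) : MvPolynomial ({e : E // v ∉ G.ends e} × Fin r) ℤ))
    have h0 : ∀ F, rename ε F =
        aeval (fun e => (X (ε e) : MvPolynomial ({e : E // v ∉ G.ends e} × Fin r) ℤ)) F :=
      DFunLike.congr_fun (algHom_ext fun e => by rw [rename_X, aeval_X])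
    rw [h0]
    refine Eq.trans h1 (Eq.trans ?_ h2.symm)
    congr 1
    ext1 i j
    simp only [Matrix.of_apply, Finset.sum_mul]
    rw [← ε.symm.sum_comp, Fintype.sum_prod_type]
    refine Finset.sum_congr rfl fun e _ => Finset.sum_congr rfl fun l _ => ?_
    rw [Equiv.apply_symm_apply]
    rfl
  rw [← topCoeff_eq_treeCoeff, ← topCoeff_rename_equiv ε, map_pow, hkir, ← map_pow,
    topCoeff_aeval_sum_X, Fintype.card_fin, Nat.card_eq_fintype_card]
  rfl

end Multigraph

/-! ### Divisibility and the main theorem -/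

namespace Multigraph

open MvPolynomial

variable {V : Type u} {E : Type w}

/-- The coefficient is a sum of multinomials `n! / ∏ c_T!` over multiplicities `c_T` of spanning
trees that cover every edge `r` times. It suffices that `∏ c_T!` divides `r! ^ k`. Its `m`-th power
is the product over all edges `e` of `∏ c_T!` with `T` through `e`, since a tree has `m` edges; each
of these `k * m` factors divides `r!`, and `m`-th roots can be taken as `m ≠ 0`. -/
theorem factorial_dvd_mul_diagonalCoeff_kirchhoff_pow [Fintype E] (G : Multigraph V E) {k m r : ℕ}
    (hV : Nat.card V = m + 1) (hm : m ≠ 0) (hE : Fintype.card E = k * m) (n : ℕ) :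
    (n ! : ℤ) ∣ (r ! : ℤ) ^ k * diagonalCoeff r (G.kirchhoff ^ n) := by
  classical
  have hcoeff (c : Finset E → ℕ) (S : Finset (Finset E)) :
      diagonalCoeff r (∏ T ∈ S, (∏ e ∈ T, (X e : MvPolynomial E ℤ)) ^ c T) =
        if (fun e => ∑ T ∈ S with e ∈ T, c T) = fun _ => r then 1 else 0 := by
    have h : (∏ T ∈ S, (∏ e ∈ T, (X e : MvPolynomial E ℤ)) ^ c T) =
        ∏ e, X e ^ (∑ T ∈ S with e ∈ T, c T) := by
      simp_rw [← Finset.prod_pow_eq_pow_sum, Finset.prod_filter, ← Finset.prod_pow]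
      rw [Finset.prod_comm]
      refine Finset.prod_congr rfl fun T _ => ?_
      rw [Finset.prod_ite_mem, Finset.univ_inter]
    rw [h, diagonalCoeff, coeff_univ_prod_X_pow]
  rw [kirchhoff, Finset.sum_pow_eq_sum_piAntidiag, diagonalCoeff, coeff_sum, Finset.mul_sum]
  refine Finset.dvd_sum fun c hc => ?_
  rw [← map_natCast (C : ℤ →+* MvPolynomial E ℤ), coeff_C_mul]
  refine (congrArg (fun x : ℤ => (n ! : ℤ) ∣ (r ! : ℤ) ^ k * (_ * x)) (hcoeff c _)).mpr ?_
  split_ifs with h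
  · generalize hS : ({T : Finset E | G.IsSpanningTree T} : Finset (Finset E)) = S at hc h ⊢
    have hcard : ∀ T ∈ S, T.card = m := by
      intro T hT
      rw [← hS, Finset.mem_filter] at hT
      have := hT.2.1
      omega
    have hdvd : ∏ T ∈ S, (c T)! ∣ r ! ^ k := by
      rw [← Nat.pow_dvd_pow_iff hm, ← pow_mul, ← hE, ← Finset.prod_pow,
        ← Finset.card_univ, ← Finset.prod_const]
      have h1 : ∏ T ∈ S, (c T)! ^ m = ∏ e, ∏ T ∈ S with e ∈ T, (c T)! := by
        simp_rw [Finset.prod_filter]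
        rw [Finset.prod_comm]
        refine Finset.prod_congr rfl fun T hT => ?_
        rw [Finset.prod_ite_mem, Finset.univ_inter, Finset.prod_const, hcard T hT]
      rw [h1]
      refine Finset.prod_dvd_prod_of_dvd _ _ fun e _ => ?_
      rw [← congrFun h e]
      exact Nat.prod_factorial_dvd_factorial_sum _ _
    rw [mul_one, ← (Finset.mem_piAntidiag.1 hc).1, ← Nat.multinomial_spec S c]
    exact_mod_cast mul_dvd_mul_right hdvd _
  · simp

theorem loopless_duplicate_iff {G : Multigraph V E} {r : ℕ} (hr : 0 < r) :
    (G.duplicate r).Loopless ↔ G.Loopless :=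
  ⟨fun h v e => h v (e, ⟨0, hr⟩), fun h v e => h v e.1⟩

theorem IsRegular.card_notMem_ends [Finite V] [Finite E] {G : Multigraph V E} {k : ℕ}
    (hG : G.IsRegular (2 * k)) {v : V} (hv : G.NoLoopAt v) :
    Nat.card {e : E // v ∉ G.ends e} = k * (Nat.card V - 2) := by
  have h1 := hG.card_edges
  have h2 := G.card_edgesAt_add v
  rw [NoLoopAt.card_edgesAt hv, hG v, h1] at h2
  rw [Nat.mul_sub, ← h2, mul_comm 2 k, Nat.add_sub_cancel_left]

theorem IsRegular.treeCoeff_duplicate_eq [Finite V] [Finite E] {G : Multigraph V E} {k : ℕ}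
    (hG : G.IsRegular (2 * k)) (hn : 2 ≤ Nat.card V) {r : ℕ} {v : V}
    (hv : G.NoLoopAt v) [Fintype {e : E // v ∉ G.ends e}] :
    (G.duplicate r).treeCoeff v (k * r) = (r ! : ℤ) ^ (k * (Nat.card V - 2)) *
      diagonalCoeff r ((G.deleteVertex v).kirchhoff ^ (k * r)) := by
  rw [treeCoeff_duplicate G hn, hG.card_notMem_ends hv]

theorem IsRegular.factorial_pow_dvd [Finite V] [Finite E] {G : Multigraph V E} {k : ℕ}
    (hG : G.IsRegular (2 * k)) (hn : 3 ≤ Nat.card V) {r : ℕ} {v : V}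
    (hv : G.NoLoopAt v) :
    ((k * r)! : ℤ) * (r ! : ℤ) ^ (k * (Nat.card V - 3)) ∣ (G.duplicate r).treeCoeff v (k * r) := by
  have := Fintype.ofFinite {e : E // v ∉ G.ends e}
  have hV := card_ne_add_one v
  have h := (G.deleteVertex v).factorial_dvd_mul_diagonalCoeff_kirchhoff_pow (k := k)
    (m := Nat.card V - 2) (r := r) (by omega) (by omega)
    (by rw [← Nat.card_eq_fintype_card, hG.card_notMem_ends hv]) (k * r)
  -- Of the `k(n - 2)` factors `r!`, `k` are spent on making the coefficient divisible by `(kr)!`;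
  -- the other `k(n - 3)` remain.
  have h2 : k * (Nat.card V - 2) = k * (Nat.card V - 3) + k := by
    rw [show Nat.card V - 2 = Nat.card V - 3 + 1 by omega, mul_add, mul_one]
  rw [hG.treeCoeff_duplicate_eq (by omega) hv, h2, pow_add, mul_assoc, mul_comm]
  exact mul_dvd_mul_left _ h

end Multigraph

open Classical in
theorem mainTheorem12 {V : Type u} {E : Type w} [Fintype V] [Fintype E]
    (G : Multigraph V E) (k : ℕ) (hG : G.IsRegular (2 * k)) (hn : 2 ≤ Fintype.card V)
    (r : ℕ) (hr : 0 < r) :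
    ∃ M : ℚ,
      (∀ q : ℚ, Multigraph.HasMartinInvariant (k * r) (G.duplicate r) q ↔ q = M) ∧
      (∀ v : V, G.NoLoopAt v →
        M = ((r ! : ℚ) ^ (k * (Fintype.card V - 2)) / ((k * r)! : ℚ)) *
          (Multigraph.diagonalCoeff r ((G.deleteVertex v).kirchhoff ^ (k * r)) : ℚ)) ∧
      (3 ≤ Fintype.card V →
        ∃ N : ℤ, M = (N : ℚ) ∧ (r ! : ℤ) ^ (k * (Fintype.card V - 3)) ∣ N) := by
  have hM (v : V) (q : ℚ) := (hG.duplicate r).hasMartinInvariant_iff (Fintype.card V)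
    Nat.card_eq_fintype_card hn v q
  have : Nonempty V := Fintype.card_pos_iff.1 (by omega)
  obtain ⟨z⟩ := this
  have hfac : ((k * r)! : ℚ) ≠ 0 := by positivity
  -- The unique value is given by the coefficient at every vertex, so the choice of `z` is
  -- immaterial.
  have hMv (v : V) : ((G.duplicate r).treeCoeff z (k * r) : ℚ) / ((k * r)! : ℚ) =
      ((G.duplicate r).treeCoeff v (k * r) : ℚ) / ((k * r)! : ℚ) :=
    (hM v _).1 ((hM z _).2 rfl)
  refine ⟨_, hM z, fun v hv => ?_, fun hn3 => ?_⟩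
  · rw [hMv v, hG.treeCoeff_duplicate_eq (by rwa [Nat.card_eq_fintype_card]) hv,
      Nat.card_eq_fintype_card]
    push_cast
    ring
  · by_cases hl : G.Loopless
    · obtain ⟨N, hN⟩ := hG.factorial_pow_dvd (by rwa [Nat.card_eq_fintype_card]) (hl z)
      refine ⟨(r ! : ℤ) ^ (k * (Fintype.card V - 3)) * N, ?_, dvd_mul_right _ _⟩
      rw [hN, Nat.card_eq_fintype_card]
      push_cast
      field_simp
    -- As `r > 0`, a loop of `G` persists in the duplication, and the value is zero.
    · refine ⟨0, ?_, dvd_zero _⟩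
      rw [(hG.duplicate r).treeCoeff_eq_zero (by rwa [Nat.card_eq_fintype_card])
        (mt (Multigraph.loopless_duplicate_iff hr).1 hl)]
      simp
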